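/- **Setting.** Let $\mathsf{HA}$ be intuitionistic (Heyting) arithmetic: intuitionistic first-order logic with equality, with the logical constants $\forall,\exists,\to,\land,\lor,\perp$ (and $\neg\varphi:\equiv\varphi\to\perp$), in the language having a function symbol for every primitive recursive function and $=$ as the only predicate symbol, with the equality axioms, the axioms $Sx\neq 0$ and $Sx=Sy\to x=y$, the defining equations of the primitive recursive functions, and induction for all formulas. Let $\mathsf{PA}$ be $\mathsf{HA}$ plus the law of excluded middle for all formulas. A theory $T$ (in the same language) is *in-between* $S$ and $R$ if every theorem of $S$ is a theorem of $T$ and every theorem of $T$ is a theorem of $R$. $\mathrm{FV}(\varphi)$ is the set of free variables of $\varphi$. **Prenex classes.** $\Sigma_0=\Pi_0$ is the class of quantifier-free formulas; $\Sigma_{k+1}$ consists of the formulas $\exists\bar x\,\psi$ with $\psi\in\Pi_k$, and $\Pi_{k+1}$ of the formulas $\forall\bar x\,\psi$ with $\psi\in\Sigma_k$, where the list $\bar x$ may be empty. **Principles.** For a class $\Gamma$ of formulas, $\Gamma\text{-}\mathrm{LEM}$ is the schema $\forall x(\varphi(x)\lor\neg\varphi(x))$ and $\Gamma\text{-}\mathrm{DNE}$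 is the schema $\forall x(\neg\neg\varphi(x)\to\varphi(x))$, where $\varphi\in\Gamma$ and $\mathrm{FV}(\varphi)\subseteq\{x\}$. $T\vdash \mathrm P$ means that $T$ proves every instance of $\mathrm P$. By convention, a principle whose index is negative has no instances: $\Pi_j\text{-}\mathrm{LEM}$ and $\Sigma_j\text{-}\mathrm{DNE}$ are the empty schema for $j<0$. **Alternation classes.** For a formula $\varphi$, the finite set $\mathrm{Alt}(\varphi)$ of finite sequences of the symbols $+$ and $-$ is $\{\langle\rangle\}$ if $\varphi$ is quantifier-free. Otherwise $\mathrm{Alt}(\neg\varphi)=\{s^\perp: s\in \mathrm{Alt}(\varphi)\}$, where $s^\perp$ is $s$ with $+$ and $-$ exchanged; $\mathrm{Alt}(\varphi\land\psi)=\mathrm{Alt}(\varphi\lor\psi)=\mathrm{Alt}(\varphi)\cup \mathrm{Alt}(\psi)$; $\mathrm{Alt}(\varphi\to\psi)=\{s^\perp:s\in \mathrm{Alt}(\varphi)\}\cup \mathrm{Alt}(\psi)$ when $\psi\not\equiv\perp$; $\mathrm{Alt}(\forall x\varphi)$ is obtained from $\mathrm{Alt}(\varphi)$ by putting $-$ in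 front of each sequence that does not already start with $-$; and $\mathrm{Alt}(\exists x\varphi)$ likewise with $+$. The degree of $\varphi$ is the maximal length of a sequence in $\mathrm{Alt}(\varphi)$. Let $\mathrm U_0=\mathrm E_0$ be the class of formulas of degree $0$; for $k\ge 1$ let $\mathrm U_k$ (resp. $\mathrm E_k$) be the class of formulas $\varphi$ of degree $k$ such that every sequence of length $k$ in $\mathrm{Alt}(\varphi)$ starts with $-$ (resp. $+$). $\Gamma^{\mathrm{df}}$ denotes the class of formulas in $\Gamma$ that do not contain $\lor$. **Prenex normal form theorem for $(\Gamma,\Gamma')$ in $T$.** $\mathrm{PNFT}_T(\Gamma,\Gamma')$ is the statement: for every $\varphi\in\Gamma$ there is $\varphi'\in\Gamma'$ with $\mathrm{FV}(\varphi)=\mathrm{FV}(\varphi')$ and $T\vdash\varphi\leftrightarrow\varphi'$. **Theorem.** Let $k$ be a natural number. 1. Let $T$ be a theory in-between $\mathsf{HA}+\Pi_{k-1}\text{-}\mathrm{LEM}$ ($\mathsf{HA}$ if $k=0$) and $\mathsf{PA}$. Then $T\vdash\Sigma_k\text{-}\mathrm{DNE}$ if and only if $\mathrm{PNFT}_T(\mathrm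 E_{k'}^{\mathrm{df}},\Sigma_{k'})$ for all $k'\le k$. 2. Let $T$ be a theory in-between $\mathsf{HA}+\Pi_{k-2}\text{-}\mathrm{LEM}$ ($\mathsf{HA}$ if $k<2$) and $\mathsf{PA}$. Then $T\vdash\Sigma_{k-1}\text{-}\mathrm{DNE}$ (a void condition if $k=0$) if and only if $\mathrm{PNFT}_T(\mathrm U_{k'}^{\mathrm{df}},\Pi_{k'})$ for all $k'\le k$. -/

import Mathlib

namespace HeytingArith

/-- Function symbols for all primitive recursive functions, indexed by their arity. -/
inductive PRSym : ℕ → Type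
  | zero : PRSym 0
  | succ : PRSym 1
  | proj {n : ℕ} (i : Fin n) : PRSym n
  | comp {m n : ℕ} (f : PRSym m) (g : Fin m → PRSym n) : PRSym n
  | prec {n : ℕ} (f : PRSym n) (g : PRSym (n + 2)) : PRSym (n + 1)

/-- The language of arithmetic with a symbol for every primitive recursive function; equality, the
only predicate, is a primitive of the formulas below. -/
def lang : FirstOrder.Language := ⟨PRSym, fun _ => Empty⟩

/-- Terms, with variables indexed by natural numbers. -/
abbrev Tm : Type := lang.Term ℕ

/-- Application of a function symbol. -/
def app {n : ℕ} (f : PRSym n) (ts : Fin n → Tm) : Tm :=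
  FirstOrder.Language.Term.func (L := lang) f ts

/-- The constant `0`. -/
def zeroT : Tm := app PRSym.zero ![]

/-- The successor of a term. -/
def succT (t : Tm) : Tm := app PRSym.succ ![t]

/-- Formulas of intuitionistic first-order arithmetic, with de Bruijn indices: in `all φ` and
`ex φ` the quantifier binds the variable `0` of `φ`, and the variable `n + 1` of `φ` is the
variable `n` of the quantified formula. -/
inductive Fml : Type
  | eq (t s : Tm) : Fml
  | bot : Fml
  | and (φ ψ : Fml) : Fml
  | or (φ ψ : Fml) : Fml
  | imp (φ ψ : Fml) : Fml
  | all (φ : Fml) : Fml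
  | ex (φ : Fml) : Fml

namespace Fml

/-- Negation, an abbreviation. -/
abbrev neg (φ : Fml) : Fml := imp φ bot

/-- Bi-implication, an abbreviation. -/
abbrev iff (φ ψ : Fml) : Fml := and (imp φ ψ) (imp ψ φ)

/-- The set of free variables. -/
def fv : Fml → Set ℕ
  | eq t s => ↑t.varFinset ∪ ↑s.varFinset
  | bot => ∅
  | and φ ψ => fv φ ∪ fv ψ
  | or φ ψ => fv φ ∪ fv ψ
  | imp φ ψ => fv φ ∪ fv ψ
  | all φ => {n | n + 1 ∈ fv φ}
  | ex φ => {n | n + 1 ∈ fv φ}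

/-- The substitution `σ` carried under a quantifier. -/
def up (σ : ℕ → Tm) : ℕ → Tm
  | 0 => FirstOrder.Language.Term.var 0
  | n + 1 => (σ n).relabel Nat.succ

/-- Simultaneous capture-avoiding substitution. -/
def subst : (ℕ → Tm) → Fml → Fml
  | σ, eq t s => eq (t.subst σ) (s.subst σ)
  | _, bot => bot
  | σ, and φ ψ => and (subst σ φ) (subst σ ψ)
  | σ, or φ ψ => or (subst σ φ) (subst σ ψ)
  | σ, imp φ ψ => imp (subst σ φ) (subst σ ψ)
  | σ, all φ => all (subst (up σ) φ)
  | σ, ex φ => ex (subst (up σ) φ)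

/-- Renaming of every free variable `n` to `n + 1`. -/
def shift (φ : Fml) : Fml := subst (fun n => FirstOrder.Language.Term.var (n + 1)) φ

/-- The instance `φ(t)` of the body `φ` of a quantified formula. -/
def inst (φ : Fml) (t : Tm) : Fml :=
  subst (fun n => Nat.casesOn n t FirstOrder.Language.Term.var) φ

/-- The formula `φ(S x)`, where `x` is the variable `0`. -/
def atSucc (φ : Fml) : Fml :=
  subst (fun n => Nat.casesOn n (succT (FirstOrder.Language.Term.var 0))
    (fun m => FirstOrder.Language.Term.var (m + 1))) φ

/-- Quantifier-free formulas. -/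
def QF : Fml → Prop
  | eq _ _ => True
  | bot => True
  | and φ ψ => QF φ ∧ QF ψ
  | or φ ψ => QF φ ∧ QF ψ
  | imp φ ψ => QF φ ∧ QF ψ
  | all _ => False
  | ex _ => False

/-- Formulas that do not contain `∨`. -/
def DisjFree : Fml → Prop
  | eq _ _ => True
  | bot => True
  | and φ ψ => DisjFree φ ∧ DisjFree ψ
  | or _ _ => False
  | imp φ ψ => DisjFree φ ∧ DisjFree ψ
  | all φ => DisjFree φ
  | ex φ => DisjFree φ

/-- `∀ x₁ … xₙ, φ`. -/
def alls : ℕ → Fml → Fml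
  | 0, φ => φ
  | n + 1, φ => all (alls n φ)

/-- `∃ x₁ … xₙ, φ`. -/
def exs : ℕ → Fml → Fml
  | 0, φ => φ
  | n + 1, φ => ex (exs n φ)

end Fml

open Fml

/-! ### Intuitionistic derivations -/

/-- Intuitionistic natural deduction: `Deriv T Γ φ` says that `φ` is derivable from the open
assumptions `Γ` and the axioms `T`. As the axioms are not subject to the eigenvariable conditions,
an axiom with free variables counts as its universal closure. -/
inductive Deriv (T : Set Fml) : List Fml → Fml → Prop
  | ax {Γ : List Fml} {φ : Fml} : φ ∈ T → Deriv T Γ φ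
  | hyp {Γ : List Fml} {φ : Fml} : φ ∈ Γ → Deriv T Γ φ
  | botE {Γ : List Fml} {φ : Fml} : Deriv T Γ bot → Deriv T Γ φ
  | andI {Γ : List Fml} {φ ψ : Fml} : Deriv T Γ φ → Deriv T Γ ψ → Deriv T Γ (and φ ψ)
  | andE₁ {Γ : List Fml} {φ ψ : Fml} : Deriv T Γ (and φ ψ) → Deriv T Γ φ
  | andE₂ {Γ : List Fml} {φ ψ : Fml} : Deriv T Γ (and φ ψ) → Deriv T Γ ψ
  | orI₁ {Γ : List Fml} {φ ψ : Fml} : Deriv T Γ φ → Deriv T Γ (or φ ψ)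
  | orI₂ {Γ : List Fml} {φ ψ : Fml} : Deriv T Γ ψ → Deriv T Γ (or φ ψ)
  | orE {Γ : List Fml} {φ ψ χ : Fml} : Deriv T Γ (or φ ψ) → Deriv T (φ :: Γ) χ →
      Deriv T (ψ :: Γ) χ → Deriv T Γ χ
  | impI {Γ : List Fml} {φ ψ : Fml} : Deriv T (φ :: Γ) ψ → Deriv T Γ (imp φ ψ)
  | impE {Γ : List Fml} {φ ψ : Fml} : Deriv T Γ (imp φ ψ) → Deriv T Γ φ → Deriv T Γ ψ
  | allI {Γ : List Fml} {φ : Fml} : Deriv T (Γ.map shift) φ → Deriv T Γ (all φ)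
  | allE {Γ : List Fml} {φ : Fml} (t : Tm) : Deriv T Γ (all φ) → Deriv T Γ (inst φ t)
  | exI {Γ : List Fml} {φ : Fml} (t : Tm) : Deriv T Γ (inst φ t) → Deriv T Γ (ex φ)
  | exE {Γ : List Fml} {φ ψ : Fml} : Deriv T Γ (ex φ) →
      Deriv T (φ :: Γ.map shift) (shift ψ) → Deriv T Γ ψ

/-- `T ⊢ φ`. A theory is given by its set of axioms. -/
def Proves (T : Set Fml) (φ : Fml) : Prop := Deriv T [] φ

/-- `T ⊢ P` for a schema `P`, that is, `T` proves every instance of `P`. -/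
def ProvesAll (T P : Set Fml) : Prop := ∀ φ ∈ P, Proves T φ

/-- `T` lies in-between `S` and `R`: it proves every theorem of `S`, and every theorem of `T` is a
theorem of `R`. -/
def InBetween (S T R : Set Fml) : Prop :=
  (∀ φ, Proves S φ → Proves T φ) ∧ (∀ φ, Proves T φ → Proves R φ)

/-! ### Arithmetic -/

/-- The axioms of intuitionistic arithmetic: equality, the successor axioms, the defining equations
of the primitive recursive functions, and induction for all formulas. -/
inductive HAAxiom : Fml → Prop
  | eqRefl (t : Tm) : HAAxiom (eq t t)
  | eqSubst (φ : Fml) (t s : Tm) : HAAxiom (imp (eq t s) (imp (inst φ t) (inst φ s)))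
  | succNeZero (t : Tm) : HAAxiom (neg (eq (succT t) zeroT))
  | succInj (t s : Tm) : HAAxiom (imp (eq (succT t) (succT s)) (eq t s))
  | proj {n : ℕ} (i : Fin n) (ts : Fin n → Tm) : HAAxiom (eq (app (PRSym.proj i) ts) (ts i))
  | comp {m n : ℕ} (f : PRSym m) (g : Fin m → PRSym n) (ts : Fin n → Tm) :
      HAAxiom (eq (app (PRSym.comp f g) ts) (app f fun j => app (g j) ts))
  | precZero {n : ℕ} (f : PRSym n) (g : PRSym (n + 2)) (ts : Fin n → Tm) :
      HAAxiom (eq (app (PRSym.prec f g) (Fin.cons zeroT ts)) (app f ts))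
  | precSucc {n : ℕ} (f : PRSym n) (g : PRSym (n + 2)) (t : Tm) (ts : Fin n → Tm) :
      HAAxiom (eq (app (PRSym.prec f g) (Fin.cons (succT t) ts))
        (app g (Fin.cons t (Fin.cons (app (PRSym.prec f g) (Fin.cons t ts)) ts))))
  | induction (φ : Fml) :
      HAAxiom (imp (inst φ zeroT) (imp (all (imp φ (atSucc φ))) (all φ)))

/-- Intuitionistic (Heyting) arithmetic. -/
def HA : Set Fml := {φ | HAAxiom φ}

/-- Classical (Peano) arithmetic: intuitionistic arithmetic with the law of excluded middle. -/
def PA : Set Fml := HA ∪ {χ | ∃ φ, χ = or φ (neg φ)}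

/-! ### Prenex classes and logical principles -/

mutual
/-- `Σ_k`: `k` alternating blocks of quantifiers, the first one existential, in front of a
quantifier-free formula; blocks may be empty. -/
def SigmaClass : ℕ → Set Fml
  | 0 => {φ | QF φ}
  | k + 1 => {φ | ∃ n : ℕ, ∃ ψ ∈ PiClass k, φ = exs n ψ}
/-- `Π_k`: `k` alternating blocks of quantifiers, the first one universal, in front of a
quantifier-free formula; blocks may be empty. -/
def PiClass : ℕ → Set Fml
  | 0 => {φ | QF φ}
  | k + 1 => {φ | ∃ n : ℕ, ∃ ψ ∈ SigmaClass k, φ = alls n ψ}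
end

/-- The schema `∀ x (φ(x) ∨ ¬ φ(x))`, for `φ` in `C` with no free variable besides `x`. -/
def LEM (C : Set Fml) : Set Fml :=
  {χ | ∃ φ ∈ C, fv φ ⊆ {0} ∧ χ = all (or φ (neg φ))}

/-- The schema `∀ x (¬¬ φ(x) → φ(x))`, for `φ` in `C` with no free variable besides `x`. -/
def DNE (C : Set Fml) : Set Fml :=
  {χ | ∃ φ ∈ C, fv φ ⊆ {0} ∧ χ = all (imp (neg (neg φ)) φ)}

/-! ### Alternation paths and the classes `F_k`, `U_k`, `E_k` -/

/-- The two symbols of alternation paths. -/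
inductive Sgn : Type
  | plus : Sgn
  | minus : Sgn
  deriving DecidableEq

/-- Exchange of `+` and `-`. -/
def Sgn.flip : Sgn → Sgn
  | plus => minus
  | minus => plus

/-- Put the symbol `a` in front of a path, unless the path starts with `a` already. -/
def extendPath (a : Sgn) (s : List Sgn) : List Sgn := if s.head? = some a then s else a :: s

/-- The set of alternation paths of a formula. On quantifier-free formulas it is `{⟨⟩}`. A negation
`¬ φ`, which is `φ → ⊥`, has a clause of its own. -/
def Fml.alt : Fml → Finset (List Sgn)
  | eq _ _ => {[]}
  | bot => {[]}
  | and φ ψ => alt φ ∪ alt ψ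
  | or φ ψ => alt φ ∪ alt ψ
  | imp φ bot => (alt φ).image (List.map Sgn.flip)
  | imp φ ψ => (alt φ).image (List.map Sgn.flip) ∪ alt ψ
  | all φ => (alt φ).image (extendPath Sgn.minus)
  | ex φ => (alt φ).image (extendPath Sgn.plus)

/-- The largest length of an alternation path. -/
def Fml.degree (φ : Fml) : ℕ := (alt φ).sup List.length

/-- Formulas of degree `k`. -/
def FClass (k : ℕ) : Set Fml := {φ | degree φ = k}

/-- `U_k`: formulas of degree `k` all of whose paths of length `k` start with `-`. -/
def UClass : ℕ → Set Fml
  | 0 => FClass 0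
  | k + 1 => {φ ∈ FClass (k + 1) | ∀ s ∈ alt φ, s.length = k + 1 → s.head? = some Sgn.minus}

/-- `E_k`: formulas of degree `k` all of whose paths of length `k` start with `+`. -/
def EClass : ℕ → Set Fml
  | 0 => FClass 0
  | k + 1 => {φ ∈ FClass (k + 1) | ∀ s ∈ alt φ, s.length = k + 1 → s.head? = some Sgn.plus}

/-- The class of formulas in `C` that do not contain `∨`. -/
def df (C : Set Fml) : Set Fml := {φ ∈ C | DisjFree φ}

/-- The prenex normal form theorem for `C` and `D` in `T`: every `φ` in `C` is `T`-equivalent to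
some `φ'` in `D` with the same free variables. -/
def PNFT (T C D : Set Fml) : Prop :=
  ∀ φ ∈ C, ∃ φ' ∈ D, fv φ = fv φ' ∧ Proves T (iff φ φ')

end HeytingArith

open HeytingArith

namespace HeytingArith

/-! ### Substitution -/

-- From DNE to prenex forms. A simultaneous induction on a disjunction-free formula
-- (`prenex_of_disjFree`) moves quantifiers outwards, spending double negation elimination only
-- where intuitionistic logic resists: turning `¬∀` into `∃¬` and reading `φ → ψ` as `¬φ ∨ ψ`.
-- Reaching `Π_k` needs DNE only for `Σ_j` with `j < k`, reaching `Σ_k` needs it also for `j = k`.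
-- The premise of an implication with `Π_k` conclusion would seem to need the higher level. It does
-- not: the conclusion is stable, so the premise matters only up to its negation, and for this a
-- weaker invariant suffices: `¬φ` is equivalent to `¬σ` for some `σ` in `Σ_k`.
--
-- From prenex forms to DNE. The key is `conservation`: if `T` has excluded middle below level `k`,
-- every `PA`-provable implication between `Σ_k` formulas is provable in `T`. It comes from a
-- negative translation in which an arbitrary formula `R` replaces falsity: `PA`-theorems become
-- `HA`-theorems, and in `T` a `Σ_k` formula `φ` translates to `(φ → R) → R`; the choice of the
-- conclusion for `R` gives back the implication. For `φ` in `Σ_k` written with a single full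
-- alternation path, `¬¬φ` lies in `E_k`, so it is equivalent to some `ψ` in `Σ_k`; `PA` proves `ψ →
-- φ`, hence so does `T`. For the second equivalence, `¬¬φ → φ` under a dummy `∀` lies in `U_{k+1}`;
-- it becomes `∀x̄ χ` with `χ` in `Σ_k`, and the `PA`-theorem `χ` transfers to `T`. Both arguments
-- go by induction on `k`: stability at lower levels turns the given `Π_j`-LEM into `Σ_j`-LEM.
--
-- Two gaps need arithmetic. The schemata have one variable while the argument needs parameters, so
-- a pairing function is verified inside `HA`. Equality of free variables is arranged at the end by
-- substituting `0` and adding trivial equations.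

abbrev var (n : ℕ) : Tm := FirstOrder.Language.Term.var n

/-- The substitution `0 ↦ t`, `n + 1 ↦ σ n`. -/
def scons (t : Tm) (σ : ℕ → Tm) : ℕ → Tm := fun n => Nat.casesOn n t σ

@[simp] theorem scons_zero (t : Tm) (σ : ℕ → Tm) : scons t σ 0 = t := rfl
@[simp] theorem scons_succ (t : Tm) (σ : ℕ → Tm) (n : ℕ) : scons t σ (n + 1) = σ n := rfl

/-- Renaming of every variable `n` of a term to `n + 1`. -/
abbrev tshift (t : Tm) : Tm := t.subst fun n => var (n + 1)

theorem term_subst_subst (t : Tm) (σ τ : ℕ → Tm) :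
    (t.subst σ).subst τ = t.subst fun n => (σ n).subst τ := by
  induction t with
  | var n => rfl
  | func f ts ih => simp [FirstOrder.Language.Term.subst, ih]

@[simp] theorem term_subst_var (t : Tm) : t.subst var = t := by
  induction t with
  | var n => rfl
  | func f ts ih => simp [FirstOrder.Language.Term.subst, ih]

theorem term_relabel_eq (t : Tm) (g : ℕ → ℕ) : t.relabel g = t.subst fun n => var (g n) := by
  induction t with
  | var n => rfl
  | func f ts ih => simp [FirstOrder.Language.Term.subst, FirstOrder.Language.Term.relabel, ih]

theorem term_subst_congr (t : Tm) {σ τ : ℕ → Tm} (h : ∀ n ∈ t.varFinset, σ n = τ n) :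
    t.subst σ = t.subst τ := by
  induction t with
  | var n => exact h n (by simp [FirstOrder.Language.Term.varFinset])
  | func f ts ih =>
    simp only [FirstOrder.Language.Term.subst]
    congr 1
    funext i
    exact ih i fun n hn => h n (by
      simp only [FirstOrder.Language.Term.varFinset, Finset.mem_biUnion]
      exact ⟨i, Finset.mem_univ _, hn⟩)

theorem mem_varFinset_subst (t : Tm) (σ : ℕ → Tm) (m : ℕ) :
    m ∈ (t.subst σ).varFinset ↔ ∃ n ∈ t.varFinset, m ∈ (σ n).varFinset := by
  induction t with
  | var n => simp [FirstOrder.Language.Term.subst, FirstOrder.Language.Term.varFinset]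
  | func f ts ih =>
    simp only [FirstOrder.Language.Term.subst, FirstOrder.Language.Term.varFinset,
      Finset.mem_biUnion, Finset.mem_univ, true_and, ih]
    tauto

namespace Fml

@[simp] theorem up_zero (σ : ℕ → Tm) : up σ 0 = var 0 := rfl
@[simp] theorem up_succ (σ : ℕ → Tm) (n : ℕ) : up σ (n + 1) = tshift (σ n) :=
  term_relabel_eq _ _

theorem up_var : up var = var := by
  funext n; cases n <;> simp [FirstOrder.Language.Term.subst]

@[simp] theorem subst_var (φ : Fml) : subst var φ = φ := by
  induction φ <;> simp_all [subst, up_var]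

theorem subst_subst (φ : Fml) (σ τ : ℕ → Tm) :
    subst τ (subst σ φ) = subst (fun n => (σ n).subst τ) φ := by
  have key (σ τ : ℕ → Tm) : (fun n => (up σ n).subst (up τ)) = up fun n => (σ n).subst τ := by
    funext n
    cases n with
    | zero => rfl
    | succ n => simp [term_subst_subst, FirstOrder.Language.Term.subst]
  induction φ generalizing σ τ <;> simp_all [subst, term_subst_subst]

theorem subst_congr (φ : Fml) {σ τ : ℕ → Tm} (h : ∀ n ∈ fv φ, σ n = τ n) :
    subst σ φ = subst τ φ := by
  induction φ generalizing σ τ with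
  | eq t s =>
    simp only [subst, fv] at h ⊢
    rw [term_subst_congr t fun n hn => h n (Or.inl hn),
      term_subst_congr s fun n hn => h n (Or.inr hn)]
  | bot => rfl
  | and φ ψ ih₁ ih₂ | or φ ψ ih₁ ih₂ | imp φ ψ ih₁ ih₂ =>
    simp only [subst, fv] at h ⊢
    rw [ih₁ fun n hn => h n (Or.inl hn), ih₂ fun n hn => h n (Or.inr hn)]
  | all φ ih | ex φ ih =>
    simp only [subst]
    rw [ih]
    intro n hn
    cases n with
    | zero => rfl
    | succ n => simp [h n hn]

theorem mem_fv_subst (φ : Fml) (σ : ℕ → Tm) (m : ℕ) :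
    m ∈ fv (subst σ φ) ↔ ∃ n ∈ fv φ, m ∈ (σ n).varFinset := by
  have key (φ : Fml) (σ : ℕ → Tm) (m : ℕ) :
      (∃ n ∈ fv φ, m + 1 ∈ (up σ n).varFinset) ↔ ∃ n, n + 1 ∈ fv φ ∧ m ∈ (σ n).varFinset := by
    constructor
    · rintro ⟨n, hn, hm⟩
      cases n with
      | zero => simp [FirstOrder.Language.Term.varFinset] at hm
      | succ n =>
        rw [up_succ, mem_varFinset_subst] at hm
        obtain ⟨j, hj, hm⟩ := hm
        simp [FirstOrder.Language.Term.varFinset] at hm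
        exact ⟨n, hn, hm ▸ hj⟩
    · rintro ⟨n, hn, hm⟩
      refine ⟨n + 1, hn, ?_⟩
      rw [up_succ, mem_varFinset_subst]
      exact ⟨m, hm, by simp [FirstOrder.Language.Term.varFinset]⟩
  induction φ generalizing σ m with
  | eq t s =>
    simp only [subst, fv, Set.mem_union, Finset.mem_coe, mem_varFinset_subst]
    aesop
  | bot => simp [subst, fv]
  | and φ ψ ih₁ ih₂ | or φ ψ ih₁ ih₂ | imp φ ψ ih₁ ih₂ =>
    simp only [subst, fv, Set.mem_union, ih₁, ih₂]
    aesop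
  | all φ ih | ex φ ih =>
    simp only [subst, fv, Set.mem_ofPred_eq, ih, key]

theorem fv_finite (φ : Fml) : (fv φ).Finite := by
  induction φ with
  | eq t s => exact (Finset.finite_toSet _).union (Finset.finite_toSet _)
  | bot => exact Set.finite_empty
  | and φ ψ ih₁ ih₂ | or φ ψ ih₁ ih₂ | imp φ ψ ih₁ ih₂ => exact ih₁.union ih₂
  | all φ ih | ex φ ih => exact ih.preimage (Nat.succ_injective.injOn)

theorem exists_fv_bound (φ : Fml) : ∃ n, ∀ i ∈ fv φ, i < n := by
  obtain ⟨n, hn⟩ := (fv_finite φ).bddAbove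
  exact ⟨n + 1, fun i hi => Nat.lt_succ_of_le (hn hi)⟩

theorem inst_eq (φ : Fml) (t : Tm) : inst φ t = subst (scons t var) φ := rfl

theorem inst_subst_up (φ : Fml) (σ : ℕ → Tm) (t : Tm) :
    inst (subst (up σ) φ) t = subst (scons t σ) φ := by
  rw [inst_eq, subst_subst]
  congr 1
  funext n
  cases n with
  | zero => rfl
  | succ n =>
    simp only [up_succ, term_subst_subst, scons_succ]
    exact term_subst_var _

theorem subst_inst (φ : Fml) (σ : ℕ → Tm) (t : Tm) :
    subst σ (inst φ t) = inst (subst (up σ) φ) (t.subst σ) := by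
  rw [inst_subst_up, inst_eq, subst_subst]
  congr 1
  funext n
  cases n <;> rfl

@[simp] theorem inst_shift (φ : Fml) (t : Tm) : inst (shift φ) t = φ := by
  rw [inst_eq, shift, subst_subst]
  exact subst_var φ

theorem subst_up_shift (φ : Fml) (σ : ℕ → Tm) :
    subst (up σ) (shift φ) = shift (subst σ φ) := by
  rw [shift, shift, subst_subst, subst_subst]
  congr 1
  funext n
  exact up_succ σ n

theorem inst_atSucc (φ : Fml) (t : Tm) : inst (atSucc φ) t = inst φ (succT t) := by
  rw [inst_eq, inst_eq, atSucc, subst_subst]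
  congr 1
  funext n
  cases n with
  | zero =>
    show (succT (var 0)).subst _ = succT t
    simp only [succT, app, FirstOrder.Language.Term.subst]
    congr 1
    funext i
    fin_cases i
    rfl
  | succ n => rfl

end Fml

open Fml

/-! ### Structural rules -/

namespace Deriv

variable {T : Set Fml}

theorem weaken {Γ Δ : List Fml} {φ : Fml} (h : Deriv T Γ φ) (hs : Γ ⊆ Δ) : Deriv T Δ φ := by
  induction h generalizing Δ with
  | ax h => exact ax h
  | hyp h => exact hyp (hs h)
  | botE _ ih => exact botE (ih hs)
  | andI _ _ ih₁ ih₂ => exact andI (ih₁ hs) (ih₂ hs)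
  | andE₁ _ ih => exact andE₁ (ih hs)
  | andE₂ _ ih => exact andE₂ (ih hs)
  | orI₁ _ ih => exact orI₁ (ih hs)
  | orI₂ _ ih => exact orI₂ (ih hs)
  | orE _ _ _ ih ih₁ ih₂ =>
    exact orE (ih hs) (ih₁ (List.cons_subset_cons _ hs)) (ih₂ (List.cons_subset_cons _ hs))
  | impI _ ih => exact impI (ih (List.cons_subset_cons _ hs))
  | impE _ _ ih₁ ih₂ => exact impE (ih₁ hs) (ih₂ hs)
  | allI _ ih => exact allI (ih (List.map_subset _ hs))
  | allE t _ ih => exact allE t (ih hs)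
  | exI t _ ih => exact exI t (ih hs)
  | exE _ _ ih₁ ih₂ =>
    exact exE (ih₁ hs) (ih₂ (List.cons_subset_cons _ (List.map_subset _ hs)))

theorem wk {Γ : List Fml} {φ ψ : Fml} (h : Deriv T Γ φ) : Deriv T (ψ :: Γ) φ :=
  h.weaken (List.subset_cons_self _ _)

theorem of_proves {Γ : List Fml} {φ : Fml} (h : Proves T φ) : Deriv T Γ φ :=
  weaken h (List.nil_subset _)

theorem hyp0 {Γ : List Fml} {φ : Fml} : Deriv T (φ :: Γ) φ := hyp (by simp)
theorem hyp1 {Γ : List Fml} {φ ψ : Fml} : Deriv T (ψ :: φ :: Γ) φ := hyp (by simp)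
theorem hyp2 {Γ : List Fml} {φ ψ χ : Fml} : Deriv T (χ :: ψ :: φ :: Γ) φ := hyp (by simp)

theorem mono {S : Set Fml} (hST : ∀ φ ∈ S, Proves T φ) {Γ : List Fml} {φ : Fml}
    (h : Deriv S Γ φ) : Deriv T Γ φ := by
  induction h with
  | ax h => exact of_proves (hST _ h)
  | hyp h => exact hyp h
  | botE _ ih => exact botE ih
  | andI _ _ ih₁ ih₂ => exact andI ih₁ ih₂
  | andE₁ _ ih => exact andE₁ ih
  | andE₂ _ ih => exact andE₂ ih
  | orI₁ _ ih => exact orI₁ ih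
  | orI₂ _ ih => exact orI₂ ih
  | orE _ _ _ ih ih₁ ih₂ => exact orE ih ih₁ ih₂
  | impI _ ih => exact impI ih
  | impE _ _ ih₁ ih₂ => exact impE ih₁ ih₂
  | allI _ ih => exact allI ih
  | allE t _ ih => exact allE t ih
  | exI t _ ih => exact exI t ih
  | exE _ _ ih₁ ih₂ => exact exE ih₁ ih₂

/-- Cut. -/
theorem cut {Γ : List Fml} {φ ψ : Fml} (h : Deriv T Γ φ) (h' : Deriv T (φ :: Γ) ψ) :
    Deriv T Γ ψ := impE (impI h') h

/-- The outermost quantifier of `alls (n + 1) φ` binds variable `n` of `φ`, so stripping from the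
outside uses the witnesses `τ n`, …, `τ 0` in this order. -/
theorem alls_elim {Γ : List Fml} (n : ℕ) (φ : Fml) (σ τ : ℕ → Tm)
    (h : Deriv T Γ (subst σ (alls n φ))) :
    Deriv T Γ (subst (fun i => if i < n then τ i else σ (i - n)) φ) := by
  induction n generalizing σ τ with
  | zero => simpa [alls] using h
  | succ n ih =>
    have h1 := allE (τ n) (h : Deriv T Γ (all (subst (up σ) (alls n φ))))
    rw [inst_subst_up] at h1
    convert ih _ τ h1 using 2
    funext i
    rcases lt_trichotomy i n with hi | rfl | hi
    · simp [hi, hi.trans (Nat.lt_succ_self n)]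
    · simp
    · obtain ⟨j, rfl⟩ := Nat.exists_eq_add_of_lt hi
      have e : n + j + 1 - n = j + 1 := by omega
      have e' : n + j + 1 - (n + 1) = j := by omega
      rw [if_neg (by omega), if_neg (by omega), e, e']
      rfl

/-- The axiom set `T` need not be closed under substitution. Since axioms escape the eigenvariable
condition, all free variables can be generalised and then instantiated. -/
theorem proves_subst {φ : Fml} (h : Proves T φ) (σ : ℕ → Tm) : Proves T (subst σ φ) := by
  obtain ⟨n, hn⟩ := exists_fv_bound φ
  have h1 (m : ℕ) : Proves T (alls m φ) := by
    induction m with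
    | zero => exact h
    | succ m ih => exact allI ih
  have h2 := alls_elim n φ var σ (by rw [subst_var]; exact h1 n)
  rwa [subst_congr φ (τ := σ)] at h2
  intro i hi
  simp [hn i hi]

theorem subst {Γ : List Fml} {φ : Fml} (h : Deriv T Γ φ) (σ : ℕ → Tm) :
    Deriv T (Γ.map (Fml.subst σ)) (Fml.subst σ φ) := by
  have hmap (Γ : List Fml) (σ : ℕ → Tm) :
      (Γ.map shift).map (Fml.subst (up σ)) = (Γ.map (Fml.subst σ)).map shift := by
    simp [Function.comp_def, subst_up_shift]
  induction h generalizing σ with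
  | ax h => exact of_proves (proves_subst (ax h) σ)
  | hyp h => exact hyp (List.mem_map_of_mem h)
  | botE _ ih => exact botE (ih σ)
  | andI _ _ ih₁ ih₂ => exact andI (ih₁ σ) (ih₂ σ)
  | andE₁ _ ih => exact andE₁ (ih σ)
  | andE₂ _ ih => exact andE₂ (ih σ)
  | orI₁ _ ih => exact orI₁ (ih σ)
  | orI₂ _ ih => exact orI₂ (ih σ)
  | orE _ _ _ ih ih₁ ih₂ => exact orE (ih σ) (ih₁ σ) (ih₂ σ)
  | impI _ ih => exact impI (ih σ)
  | impE _ _ ih₁ ih₂ => exact impE (ih₁ σ) (ih₂ σ)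
  | allI _ ih =>
    have := ih (up σ)
    rw [hmap] at this
    exact allI this
  | allE t _ ih =>
    rw [subst_inst]
    exact allE _ (ih σ)
  | exI t _ ih =>
    have := ih σ
    rw [subst_inst] at this
    exact exI _ this
  | exE _ _ ih₁ ih₂ =>
    have := ih₂ (up σ)
    rw [List.map_cons, hmap, subst_up_shift] at this
    exact exE (ih₁ σ) this

theorem exists_fresh (L : List Fml) : ∃ n, ∀ φ ∈ L, ∀ i ∈ fv φ, i < n := by
  induction L with
  | nil => exact ⟨0, by simp⟩
  | cons φ L ih =>
    obtain ⟨n, hn⟩ := ih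
    obtain ⟨m, hm⟩ := exists_fv_bound φ
    refine ⟨max n m, fun ψ hψ i hi => ?_⟩
    rcases List.mem_cons.1 hψ with rfl | hψ
    · exact lt_max_of_lt_right (hm i hi)
    · exact lt_max_of_lt_left (hn ψ hψ i hi)

/-- The substitution that turns a fresh variable `n` into the variable `0` of a shifted context. -/
def bindVar (n : ℕ) : ℕ → Tm := fun i => if i = n then var 0 else var (i + 1)

theorem subst_bindVar {n : ℕ} {φ : Fml} (h : ∀ i ∈ fv φ, i < n) :
    Fml.subst (bindVar n) φ = shift φ :=
  subst_congr φ fun i hi => by simp [bindVar, (h i hi).ne]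

theorem map_subst_bindVar {n : ℕ} {Γ : List Fml} (h : ∀ φ ∈ Γ, ∀ i ∈ fv φ, i < n) :
    Γ.map (Fml.subst (bindVar n)) = Γ.map shift :=
  List.map_congr_left fun φ hφ => subst_bindVar (h φ hφ)

theorem subst_bindVar_inst {n : ℕ} {φ : Fml} (h : ∀ i ∈ fv φ, i < n) :
    Fml.subst (bindVar n) (inst φ (var n)) = φ := by
  rw [inst_eq, subst_subst]
  conv_rhs => rw [← subst_var φ]
  refine subst_congr φ fun i hi => ?_
  cases i with
  | zero => simp [FirstOrder.Language.Term.subst, bindVar]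
  | succ i =>
    have := h _ hi
    simp [FirstOrder.Language.Term.subst, bindVar, show i ≠ n by omega]

/-- Only the instance at a fresh variable is used, renamed afterwards to the bound one. Stating it
for all `t` frees later derivations from shifted contexts; `ex_elim` is its dual. -/
theorem all_intro {Γ : List Fml} {φ : Fml} (h : ∀ t, Deriv T Γ (inst φ t)) :
    Deriv T Γ (all φ) := by
  obtain ⟨n, hn⟩ := exists_fresh (φ :: Γ)
  have h1 := (h (var n)).subst (bindVar n)
  rw [map_subst_bindVar fun ψ hψ => hn ψ (List.mem_cons_of_mem _ hψ),
    subst_bindVar_inst (hn φ List.mem_cons_self)] at h1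
  exact allI h1

theorem ex_elim {Γ : List Fml} {φ χ : Fml} (h : Deriv T Γ (ex φ))
    (h' : ∀ t, Deriv T (inst φ t :: Γ) χ) : Deriv T Γ χ := by
  obtain ⟨n, hn⟩ := exists_fresh (χ :: φ :: Γ)
  have h1 := (h' (var n)).subst (bindVar n)
  rw [List.map_cons, map_subst_bindVar fun ψ hψ => hn ψ (by simp [hψ]),
    subst_bindVar_inst (hn φ (by simp)), subst_bindVar (hn χ (by simp))] at h1
  exact exE h h1

end Deriv

open Fml

/-! ### Decision of intuitionistic propositional tautologies -/

/-- Propositional formulas. -/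
inductive PF : Type
  | atom (n : ℕ) : PF
  | bot : PF
  | and (p q : PF) : PF
  | or (p q : PF) : PF
  | imp (p q : PF) : PF

namespace PF

/-- The instance of a propositional formula under an assignment of formulas to the atoms. -/
def interp (v : List Fml) : PF → Fml
  | .atom n => v.getD n Fml.bot
  | bot => Fml.bot
  | and p q => Fml.and (interp v p) (interp v q)
  | or p q => Fml.or (interp v p) (interp v q)
  | imp p q => Fml.imp (interp v p) (interp v q)

/-- Boolean equality. -/
def same : PF → PF → Bool
  | .atom n, .atom m => Nat.beq n m
  | bot, bot => true
  | and p q, and p' q' => same p p' && same q q'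
  | or p q, or p' q' => same p p' && same q q'
  | imp p q, imp p' q' => same p p' && same q q'
  | _, _ => false

theorem eq_of_same : ∀ {p q : PF}, same p q = true → p = q
  | .atom n, .atom m, h => by rw [Nat.eq_of_beq_eq_true h]
  | bot, bot, _ => rfl
  | and p q, and p' q', h | or p q, or p' q', h | imp p q, imp p' q', h => by
    simp only [same, Bool.and_eq_true] at h
    rw [eq_of_same h.1, eq_of_same h.2]

/-- Boolean membership. -/
def memb (p : PF) : List PF → Bool
  | [] => false
  | q :: L => same p q || memb p L

theorem mem_of_memb {p : PF} : ∀ {L : List PF}, memb p L = true → p ∈ L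
  | q :: L, h => by
    simp only [memb, Bool.or_eq_true] at h
    rcases h with h | h
    · rw [eq_of_same h]; exact List.mem_cons_self
    · exact List.mem_cons_of_mem _ (mem_of_memb h)

/-- All ways to select one element of a list (`acc` holds elements passed over). -/
def picks (acc : List PF) : List PF → List (PF × List PF)
  | [] => []
  | p :: L => (p, acc ++ L) :: picks (p :: acc) L

theorem subset_of_mem_picks {x : PF × List PF} :
    ∀ {L acc : List PF}, x ∈ picks acc L → x.1 :: x.2 ⊆ acc ++ L
  | p :: L, acc, h => by
    rcases List.mem_cons.1 h with rfl | h
    · intro y hy; simp at hy ⊢; tauto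
    · intro y hy
      have := subset_of_mem_picks h hy
      simp at this ⊢; tauto

/-- The invertible left rules: the premises into which the assumption `p` is broken up. -/
def left (p : PF) (Γ : List PF) : Option (List (List PF)) :=
  match p with
  | bot => some []
  | and a b => some [a :: b :: Γ]
  | or a b => some [a :: Γ, b :: Γ]
  | imp (.atom n) b => if memb (.atom n) Γ then some [b :: Γ] else none
  | imp bot _ => some [Γ]
  | imp (and c d) b => some [imp c (imp d b) :: Γ]
  | imp (or c d) b => some [imp c b :: imp d b :: Γ]
  | _ => none

/-- The first applicable invertible left rule. -/
def firstLeft : List (PF × List PF) → Option (List (List PF))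
  | [] => none
  | x :: L => match left x.1 x.2 with
    | some r => some r
    | none => firstLeft L

/-- Contraction-free proof search, with bounded depth. -/
def prove : ℕ → List PF → PF → Bool
  | 0, _, _ => false
  | n + 1, Γ, g =>
    memb g Γ ||
    match g with
    | imp a b => prove n (a :: Γ) b
    | and a b => prove n Γ a && prove n Γ b
    | g =>
      match firstLeft (picks [] Γ) with
      | some L => L.all fun Δ => prove n Δ g
      | none =>
        (match g with
          | or a b => prove n Γ a || prove n Γ b
          | _ => false) ||
        (picks [] Γ).any fun x => match x.1 with
          | imp (imp c d) b => prove n (c :: imp d b :: x.2) d && prove n (b :: x.2) g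
          | _ => false

variable {T : Set Fml} {v : List Fml}

open Deriv in
theorem left_sound {p : PF} {Γ : List PF} {L : List (List PF)} (h : left p Γ = some L) {g : Fml}
    (hL : ∀ Δ ∈ L, Deriv T (Δ.map (interp v)) g) :
    Deriv T ((p :: Γ).map (interp v)) g := by
  have sub {a : Fml} {Δ : List Fml} : Δ ⊆ a :: Δ := List.subset_cons_self _ _
  unfold left at h
  split at h
  · exact botE hyp0
  · obtain rfl := Option.some.inj h
    have := hL _ List.mem_cons_self
    refine cut (andE₁ hyp0) (cut (andE₂ hyp1) (this.weaken ?_))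
    intro x; simp; tauto
  · obtain rfl := Option.some.inj h
    refine orE hyp0 ((hL _ List.mem_cons_self).weaken ?_)
      ((hL _ (List.mem_cons_of_mem _ List.mem_cons_self)).weaken ?_) <;>
    · intro x; simp; tauto
  · split at h
    · rename_i hm
      obtain rfl := Option.some.inj h
      refine cut (impE hyp0 (hyp (List.mem_cons_of_mem _ (List.mem_map_of_mem (mem_of_memb hm)))))
        ((hL _ List.mem_cons_self).weaken ?_)
      intro x; simp; tauto
    · cases h
  · obtain rfl := Option.some.inj h
    exact (hL _ List.mem_cons_self).weaken sub
  · obtain rfl := Option.some.inj h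
    refine cut (impI (impI (impE hyp2 (andI hyp1 hyp0)))) ((hL _ List.mem_cons_self).weaken ?_)
    intro x; simp; tauto
  · obtain rfl := Option.some.inj h
    refine cut (impI (impE hyp1 (orI₁ hyp0))) (cut (impI (impE hyp2 (orI₂ hyp0)))
      ((hL _ List.mem_cons_self).weaken ?_))
    intro x; simp; tauto
  · cases h

theorem firstLeft_some {X : List (PF × List PF)} {L : List (List PF)} (h : firstLeft X = some L) :
    ∃ x ∈ X, left x.1 x.2 = some L := by
  induction X with
  | nil => cases h
  | cons x X ih =>
    unfold firstLeft at h
    split at h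
    · rename_i r hr
      exact ⟨x, List.mem_cons_self, hr.trans h⟩
    · obtain ⟨y, hy, e⟩ := ih h
      exact ⟨y, List.mem_cons_of_mem _ hy, e⟩

open Deriv in
theorem prove_sound {n : ℕ} {Γ : List PF} {g : PF} (h : prove n Γ g = true) :
    Deriv T (Γ.map (interp v)) (interp v g) := by
  induction n generalizing Γ g with
  | zero => cases h
  | succ n ih =>
    have hpick {x : PF × List PF} (hx : x ∈ picks [] Γ) {χ : Fml}
        (hd : Deriv T ((x.1 :: x.2).map (interp v)) χ) : Deriv T (Γ.map (interp v)) χ :=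
      hd.weaken (List.map_subset _ (subset_of_mem_picks hx))
    unfold prove at h
    rcases (Bool.or_eq_true _ _).mp h with h | h
    · exact hyp (List.mem_map_of_mem (mem_of_memb h))
    split at h
    · exact impI (ih h)
    · rw [Bool.and_eq_true] at h
      exact andI (ih h.1) (ih h.2)
    · split at h
      · rename_i L hL
        obtain ⟨x, hx, e⟩ := firstLeft_some hL
        exact hpick hx (left_sound e fun Δ hΔ => ih (List.all_eq_true.1 h Δ hΔ))
      · rcases (Bool.or_eq_true _ _).mp h with h | h
        · split at h
          · rcases (Bool.or_eq_true _ _).mp h with h | h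
            · exact orI₁ (ih h)
            · exact orI₂ (ih h)
          · cases h
        · obtain ⟨x, hx, h⟩ := List.any_eq_true.1 h
          refine hpick hx ?_
          obtain ⟨p, Δ⟩ := x
          dsimp only at h
          split at h
          · rename_i c d b
            rw [Bool.and_eq_true] at h
            have h1 := ih h.1
            have h2 := ih h.2
            simp only [List.map_cons, interp] at h1 h2 ⊢
            -- The search keeps only `d → b` from `(c → d) → b`; it follows because `d` implies `c →
            -- d`.
            have h3 : Deriv T (Fml.imp (Fml.imp (interp v c) (interp v d)) (interp v b) ::
                Δ.map (interp v)) (Fml.imp (interp v c) (interp v d)) := by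
              refine impI (cut (impI (impE hyp2 (impI hyp1))) (h1.weaken ?_))
              intro x; simp; tauto
            refine cut (impE hyp0 h3) (h2.weaken ?_)
            intro x; simp; tauto
          · cases h

/-- Negation. -/
abbrev neg (p : PF) : PF := imp p bot

/-- Bi-implication. -/
abbrev iff (p q : PF) : PF := and (imp p q) (imp q p)

/-- These instances supply notation only; no Heyting algebra laws are claimed. -/
instance : HImp PF := ⟨imp⟩
instance : Min PF := ⟨and⟩
instance : Max PF := ⟨or⟩
instance : Bot PF := ⟨bot⟩
instance : Compl PF := ⟨neg⟩

end PF

abbrev x₀ : PF := PF.atom 0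
abbrev x₁ : PF := PF.atom 1
abbrev x₂ : PF := PF.atom 2

/-- Proof by reflection: the search is evaluated by `rfl`, and only its soundness is needed. The
number 40 bounds the search depth. -/
theorem Deriv.taut {T : Set Fml} {Γ : List Fml} (v : List Fml) (p : PF)
    (h : PF.prove 40 [] p = true) : Deriv T Γ (p.interp v) :=
  Deriv.of_proves (PF.prove_sound h)

open Fml Deriv

/-! ### Equality and induction in Heyting arithmetic -/

abbrev ap1 (f : PRSym 1) (t : Tm) : Tm := app f ![t]
abbrev ap2 (f : PRSym 2) (t s : Tm) : Tm := app f ![t, s]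

@[simp] theorem var_subst (n : ℕ) (σ : ℕ → Tm) : (var n).subst σ = σ n := rfl

theorem app_subst {n : ℕ} (f : PRSym n) (ts : Fin n → Tm) (σ : ℕ → Tm) :
    (app f ts).subst σ = app f fun i => (ts i).subst σ := rfl

@[simp] theorem ap1_subst (f : PRSym 1) (t : Tm) (σ : ℕ → Tm) :
    (ap1 f t).subst σ = ap1 f (t.subst σ) := by
  rw [app_subst]; congr 1; funext i; fin_cases i; rfl

@[simp] theorem ap2_subst (f : PRSym 2) (t s : Tm) (σ : ℕ → Tm) :
    (ap2 f t s).subst σ = ap2 f (t.subst σ) (s.subst σ) := by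
  rw [app_subst]; congr 1; funext i; fin_cases i <;> rfl

@[simp] theorem succT_subst (t : Tm) (σ : ℕ → Tm) : (succT t).subst σ = succT (t.subst σ) :=
  ap1_subst _ _ _

@[simp] theorem zeroT_subst (σ : ℕ → Tm) : zeroT.subst σ = zeroT := by
  rw [zeroT, app_subst]; congr 1; funext i; exact i.elim0

theorem tshift_scons (t s : Tm) (σ : ℕ → Tm) : (tshift t).subst (scons s σ) = t.subst σ := by
  rw [term_subst_subst]; rfl

@[simp] theorem tshift_scons_var (t s : Tm) : (tshift t).subst (scons s var) = t := by
  rw [tshift_scons, term_subst_var]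

namespace HA

variable {Γ : List Fml}

theorem ax {φ : Fml} (h : HAAxiom φ) : Deriv HA Γ φ := Deriv.ax h

theorem eq_refl (t : Tm) : Deriv HA Γ (eq t t) := ax (.eqRefl t)

theorem eq_replace (φ : Fml) {t s : Tm} (h : Deriv HA Γ (eq t s)) (h' : Deriv HA Γ (inst φ t)) :
    Deriv HA Γ (inst φ s) := impE (impE (ax (.eqSubst φ t s)) h) h'

theorem eq_symm {t s : Tm} (h : Deriv HA Γ (eq t s)) : Deriv HA Γ (eq s t) := by
  have := eq_replace (eq (var 0) (tshift t)) h
  simp only [inst_eq, Fml.subst, var_subst, scons_zero, tshift_scons_var] at this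
  exact this (eq_refl t)

theorem eq_trans {t s r : Tm} (h : Deriv HA Γ (eq t s)) (h' : Deriv HA Γ (eq s r)) :
    Deriv HA Γ (eq t r) := by
  have := eq_replace (eq (tshift t) (var 0)) h'
  simp only [inst_eq, Fml.subst, var_subst, scons_zero, tshift_scons_var] at this
  exact this h

/-- Leibniz's axiom replaces one term at a time. At stage `n` the slot of variable `n` becomes
variable `0` of an auxiliary formula, the others being shifted out of its way. -/
theorem replace_upto (φ : Fml) (σ τ : ℕ → Tm) (n : ℕ) (h : ∀ i < n, Deriv HA Γ (eq (σ i) (τ i)))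
    (h' : Deriv HA Γ (subst σ φ)) :
    Deriv HA Γ (subst (fun i => if i < n then τ i else σ i) φ) := by
  induction n with
  | zero => simpa using h'
  | succ n ih =>
    have h1 := ih fun i hi => h i (hi.trans n.lt_succ_self)
    have key := eq_replace (Γ := Γ) (subst (fun i => if i < n then tshift (τ i) else
      if i = n then var 0 else tshift (σ i)) φ) (h n n.lt_succ_self)
    simp only [inst_eq, subst_subst] at key
    convert key ?_ using 2
    · funext i
      rcases lt_trichotomy i n with hi | rfl | hi
      · simp [hi, hi.trans n.lt_succ_self]
      · simp
      · simp [hi.ne', hi.le.not_gt, show ¬ i < n + 1 by omega]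
    · convert h1 using 2
      funext i
      rcases lt_trichotomy i n with hi | rfl | hi
      · simp [hi]
      · simp
      · simp [hi.ne', hi.le.not_gt]

theorem replace {φ : Fml} {n : ℕ} (hn : ∀ i ∈ fv φ, i < n) {σ τ : ℕ → Tm}
    (h : ∀ i < n, Deriv HA Γ (eq (σ i) (τ i))) (h' : Deriv HA Γ (subst σ φ)) :
    Deriv HA Γ (subst τ φ) := by
  have := replace_upto φ σ τ n h h'
  rwa [subst_congr φ (τ := τ)] at this
  intro i hi
  simp [hn i hi]

theorem app_congr {n : ℕ} (f : PRSym n) {ts ss : Fin n → Tm}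
    (h : ∀ i, Deriv HA Γ (eq (ts i) (ss i))) : Deriv HA Γ (eq (app f ts) (app f ss)) := by
  -- The template is `f(x_n, …) = f(x_0, …)` with both sides instantiated by `ts`; only the first
  -- `n` variables, hence only the right side, are then replaced by `ss`.
  have key := replace_upto (Γ := Γ) (eq (app f fun i : Fin n => var (n + i)) (app f fun i => var i))
    (fun j => if h : j < n then ts ⟨j, h⟩ else if h : j - n < n then ts ⟨j - n, h⟩ else zeroT)
    (fun j => if h : j < n then ss ⟨j, h⟩ else zeroT) n (fun i hi => by simpa [hi] using h _)
  simp only [Fml.subst, app_subst, var_subst] at key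
  simp at key
  exact key (eq_refl _)

theorem ap1_congr (f : PRSym 1) {t s : Tm} (h : Deriv HA Γ (eq t s)) :
    Deriv HA Γ (eq (ap1 f t) (ap1 f s)) :=
  app_congr f fun i => by fin_cases i; exact h

theorem ap2_congr (f : PRSym 2) {t s t' s' : Tm} (h : Deriv HA Γ (eq t s))
    (h' : Deriv HA Γ (eq t' s')) : Deriv HA Γ (eq (ap2 f t t') (ap2 f s s')) :=
  app_congr f fun i => by fin_cases i; exacts [h, h']

theorem succ_congr {t s : Tm} (h : Deriv HA Γ (eq t s)) :
    Deriv HA Γ (eq (succT t) (succT s)) := ap1_congr _ h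

theorem ind (φ : Fml) (P : Tm → Fml) (hP : ∀ t, inst φ t = P t) (h0 : Deriv HA Γ (P zeroT))
    (hs : ∀ t, Deriv HA (P t :: Γ) (P (succT t))) (t : Tm) : Deriv HA Γ (P t) := by
  rw [← hP]
  refine allE t (impE (impE (ax (.induction φ)) (by rwa [hP])) (all_intro fun s => ?_))
  show Deriv HA Γ (imp (inst φ s) (inst (atSucc φ) s))
  rw [inst_atSucc, hP, hP]
  exact impI (hs s)

/-- Double induction: the outer one, on `t`, must carry a universal quantifier over the other term,
because the successor case appeals to its predecessor. -/
theorem eq_dec (t s : Tm) : Deriv HA Γ (or (eq t s) (neg (eq t s))) := by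
  have hall (t : Tm) : Deriv HA Γ (all (or (eq (tshift t) (var 0)) (neg (eq (tshift t) (var 0))))) := by
    refine ind (all (or (eq (var 1) (var 0)) (neg (eq (var 1) (var 0)))))
      (fun t => all (or (eq (tshift t) (var 0)) (neg (eq (tshift t) (var 0)))))
      (fun t => by simp [inst_eq, Fml.subst]) ?_ (fun t => ?_) t
    · refine all_intro fun s => ?_
      simp only [inst_eq, Fml.subst, var_subst, scons_zero, tshift_scons_var]
      refine ind (or (eq zeroT (var 0)) (neg (eq zeroT (var 0))))
        (fun s => or (eq zeroT s) (neg (eq zeroT s))) (fun s => by simp [inst_eq, Fml.subst])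
        (orI₁ (eq_refl _)) (fun s => ?_) s
      exact orI₂ (impI (impE (ax (.succNeZero s)) (eq_symm hyp0)))
    · refine all_intro fun s => ?_
      simp only [inst_eq, Fml.subst, var_subst, scons_zero, tshift_scons_var]
      refine ind (or (eq (succT (tshift t)) (var 0)) (neg (eq (succT (tshift t)) (var 0))))
        (fun s => or (eq (succT t) s) (neg (eq (succT t) s)))
        (fun s => by simp [inst_eq, Fml.subst])
        (orI₂ (ax (.succNeZero t))) (fun s => ?_) s
      have h1 := allE s (Γ := or (eq (succT t) s) (neg (eq (succT t) s)) ::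
        all (or (eq (tshift t) (var 0)) (neg (eq (tshift t) (var 0)))) :: Γ) (T := HA) hyp1
      simp only [inst_eq, Fml.subst, var_subst, scons_zero, tshift_scons_var] at h1
      refine orE h1 (orI₁ (succ_congr hyp0)) (orI₂ (impI (impE hyp1 ?_)))
      exact impE (ax (.succInj t s)) hyp0
  have := allE s (hall t)
  simpa only [inst_eq, Fml.subst, var_subst, scons_zero, tshift_scons_var] using this

theorem qf_dec {φ : Fml} (h : QF φ) : Deriv HA Γ (or φ (neg φ)) := by
  induction φ with
  | eq t s => exact eq_dec t s
  | bot => exact orI₂ (impI hyp0)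
  | and φ ψ ih₁ ih₂ =>
    exact impE (impE (taut [φ, ψ] ((x₀ ⊔ x₀ᶜ) ⇨ (x₁ ⊔ x₁ᶜ) ⇨ (x₀ ⊓ x₁) ⊔ (x₀ ⊓ x₁)ᶜ) rfl)
      (ih₁ h.1)) (ih₂ h.2)
  | or φ ψ ih₁ ih₂ =>
    exact impE (impE (taut [φ, ψ] ((x₀ ⊔ x₀ᶜ) ⇨ (x₁ ⊔ x₁ᶜ) ⇨ (x₀ ⊔ x₁) ⊔ (x₀ ⊔ x₁)ᶜ) rfl)
      (ih₁ h.1)) (ih₂ h.2)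
  | imp φ ψ ih₁ ih₂ =>
    exact impE (impE (taut [φ, ψ] ((x₀ ⊔ x₀ᶜ) ⇨ (x₁ ⊔ x₁ᶜ) ⇨ (x₀ ⇨ x₁) ⊔ (x₀ ⇨ x₁)ᶜ) rfl)
      (ih₁ h.1)) (ih₂ h.2)
  | all φ => exact h.elim
  | ex φ => exact h.elim

/-! ### Primitive recursive functions in Heyting arithmetic -/

/-- A function symbol for the function given by a term with the variables `0, …, n - 1`. -/
def symOf (n : ℕ) : Tm → PRSym n
  | .var i => if h : i < n then PRSym.proj ⟨i, h⟩ else PRSym.comp PRSym.zero ![]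
  | .func (f : PRSym _) ts => PRSym.comp f fun j => symOf n (ts j)

/-- The substitution given by finitely many terms. -/
def finSub {n : ℕ} (ts : Fin n → Tm) : ℕ → Tm := fun i => if h : i < n then ts ⟨i, h⟩ else zeroT

theorem symOf_eq {n : ℕ} (t : Tm) (ts : Fin n → Tm) :
    Deriv HA Γ (eq (app (symOf n t) ts) (t.subst (finSub ts))) := by
  induction t with
  | var i =>
    rw [var_subst, symOf, finSub]
    split
    · exact ax (.proj _ _)
    · refine eq_trans (ax (.comp _ _ _)) (app_congr _ fun i => i.elim0)
  | func f us ih =>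
    exact eq_trans (ax (.comp _ _ _)) (app_congr _ ih)

theorem prec_succ {n : ℕ} (f : PRSym n) (g : Tm) (t : Tm) (ts : Fin n → Tm) :
    Deriv HA Γ (eq (app (PRSym.prec f (symOf (n + 2) g)) (Fin.cons (succT t) ts))
      (g.subst (finSub (Fin.cons t (Fin.cons
        (app (PRSym.prec f (symOf (n + 2) g)) (Fin.cons t ts)) ts))))) :=
  eq_trans (ax (.precSucc _ _ _ _)) (symOf_eq _ _)

/-- Addition. -/
def addS : PRSym 2 := .prec (symOf 1 (var 0)) (symOf 3 (succT (var 1)))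
/-- Predecessor. -/
def predS : PRSym 1 := .prec .zero (symOf 2 (var 0))
/-- Truncated subtraction of the first argument from the second. -/
def monS : PRSym 2 := .prec (symOf 1 (var 0)) (symOf 3 (ap1 predS (var 1)))
/-- The function with `c(0, a) = a + 1` and `c(y + 1, a) = a`. -/
def condS : PRSym 2 := .prec (symOf 1 (succT (var 0))) (symOf 3 (var 2))
/-- Triangular numbers, shifted: `t(0) = 0` and `t(n + 1) = t(n) + n + 1`. -/
def triS : PRSym 1 := .prec .zero (symOf 2 (succT (ap2 addS (var 1) (var 0))))
/-- The row of a number in the triangular enumeration of pairs. -/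
def rowS : PRSym 1 := .prec .zero
  -- If `n` lies in row `s` at position `x = n - t(s)`, then `n + 1` opens row `s + 1` exactly when
  -- `s - x` is `0`; `condS` makes this case distinction.
  (symOf 2 (ap2 condS (ap2 monS (ap2 monS (ap1 triS (var 1)) (var 0)) (var 1)) (var 1)))

abbrev add : Tm → Tm → Tm := ap2 addS
abbrev pred : Tm → Tm := ap1 predS
abbrev mon : Tm → Tm → Tm := ap2 monS
abbrev cond : Tm → Tm → Tm := ap2 condS
abbrev tri : Tm → Tm := ap1 triS
abbrev row : Tm → Tm := ap1 rowS

theorem zero_add (s : Tm) : Deriv HA Γ (eq (add zeroT s) s) :=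
  eq_trans (ax (.precZero _ _ ![s])) (symOf_eq (var 0) _)

theorem succ_add (t s : Tm) : Deriv HA Γ (eq (add (succT t) s) (succT (add t s))) := by
  have := prec_succ (Γ := Γ) (symOf 1 (var 0)) (succT (var 1)) t ![s]
  rwa [succT_subst] at this

theorem pred_succ (t : Tm) : Deriv HA Γ (eq (pred (succT t)) t) :=
  prec_succ PRSym.zero (var 0) t ![]

theorem zero_mon (s : Tm) : Deriv HA Γ (eq (mon zeroT s) s) :=
  eq_trans (ax (.precZero _ _ ![s])) (symOf_eq (var 0) _)

theorem succ_mon (t s : Tm) : Deriv HA Γ (eq (mon (succT t) s) (pred (mon t s))) := by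
  have := prec_succ (Γ := Γ) (symOf 1 (var 0)) (pred (var 1)) t ![s]
  rwa [ap1_subst] at this

theorem zero_cond (s : Tm) : Deriv HA Γ (eq (cond zeroT s) (succT s)) := by
  have := eq_trans (ax (.precZero _ (symOf 3 (var 2)) ![s])) (symOf_eq (Γ := Γ) (succT (var 0)) _)
  rwa [succT_subst] at this

theorem succ_cond (t s : Tm) : Deriv HA Γ (eq (cond (succT t) s) s) :=
  prec_succ _ (var 2) t ![s]

theorem tri_zero : Deriv HA Γ (eq (tri zeroT) zeroT) := ax (.precZero _ _ ![])

theorem tri_succ (t : Tm) : Deriv HA Γ (eq (tri (succT t)) (succT (add (tri t) t))) := by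
  have := prec_succ (Γ := Γ) PRSym.zero (succT (add (var 1) (var 0))) t ![]
  rwa [succT_subst, ap2_subst] at this

theorem row_zero : Deriv HA Γ (eq (row zeroT) zeroT) := ax (.precZero _ _ ![])

theorem row_succ (t : Tm) : Deriv HA Γ (eq (row (succT t))
    (cond (mon (mon (tri (row t)) t) (row t)) (row t))) := by
  have := prec_succ (Γ := Γ) PRSym.zero
    (cond (mon (mon (tri (var 1)) (var 0)) (var 1)) (var 1)) t ![]
  rwa [ap2_subst, ap2_subst, ap2_subst, ap1_subst] at this

theorem add_zero (t : Tm) : Deriv HA Γ (eq (add t zeroT) t) :=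
  ind (eq (add (var 0) zeroT) (var 0)) (fun t => eq (add t zeroT) t)
    (fun t => by simp [inst_eq, Fml.subst]) (zero_add _)
    (fun t => eq_trans (succ_add t zeroT) (succ_congr hyp0)) t

theorem add_succ (t s : Tm) : Deriv HA Γ (eq (add t (succT s)) (succT (add t s))) :=
  ind (eq (add (var 0) (succT (tshift s))) (succT (add (var 0) (tshift s))))
    (fun t => eq (add t (succT s)) (succT (add t s)))
    (fun t => by simp [inst_eq, Fml.subst])
    (eq_trans (zero_add _) (eq_symm (succ_congr (zero_add _))))
    (fun t => eq_trans (succ_add t _) (succ_congr (eq_trans hyp0 (eq_symm (succ_add t s))))) t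

theorem pred_mon_succ (t s : Tm) : Deriv HA Γ (eq (pred (mon t (succT s))) (mon t s)) :=
  ind (eq (pred (mon (var 0) (succT (tshift s)))) (mon (var 0) (tshift s)))
    (fun t => eq (pred (mon t (succT s))) (mon t s))
    (fun t => by simp [inst_eq, Fml.subst])
    (eq_trans (ap1_congr _ (zero_mon _)) (eq_trans (pred_succ s) (eq_symm (zero_mon s))))
    (fun t => eq_trans (ap1_congr _ (succ_mon t _))
      (eq_trans (ap1_congr _ hyp0) (eq_symm (succ_mon t s)))) t

theorem mon_add (t s : Tm) : Deriv HA Γ (eq (mon t (add t s)) s) :=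
  ind (eq (mon (var 0) (add (var 0) (tshift s))) (tshift s))
    (fun t => eq (mon t (add t s)) s)
    (fun t => by simp [inst_eq, Fml.subst])
    (eq_trans (zero_mon _) (zero_add s))
    (fun t => eq_trans (ap2_congr _ (eq_refl _) (succ_add t s))
      (eq_trans (succ_mon t _) (eq_trans (pred_mon_succ t _) hyp0))) t

/-- The row of the successor of `t(s) + x`, for `x + y = s`. -/
theorem row_succ_add {s x y : Tm} (hr : Deriv HA Γ (eq (row (add (tri s) x)) s))
    (h : Deriv HA Γ (eq (add x y) s)) :
    Deriv HA Γ (eq (row (succT (add (tri s) x))) (cond y s)) := by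
  refine eq_trans (row_succ _) (ap2_congr _ ?_ hr)
  refine eq_trans (ap2_congr _ (eq_trans (ap2_congr _ (ap1_congr _ hr) (eq_refl _))
    (mon_add (tri s) x)) (eq_trans hr (eq_symm h))) (mon_add x y)

/-- Induction on the position `x` in row `s`. The bound `x ≤ s` is expressed by `x + y = s`, so no
order relation is needed; `y` is quantified because it grows as `x` decreases. -/
theorem row_add_aux {s : Tm} (hs : Deriv HA Γ (eq (row (tri s)) s)) (x : Tm) :
    Deriv HA Γ (all (imp (eq (add (tshift x) (var 0)) (tshift s))
      (eq (row (add (tri (tshift s)) (tshift x))) (tshift s)))) := by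
  refine ind (all (imp (eq (add (var 1) (var 0)) (tshift (tshift s)))
      (eq (row (add (tri (tshift (tshift s))) (var 1))) (tshift (tshift s)))))
    (fun x => all (imp (eq (add (tshift x) (var 0)) (tshift s))
      (eq (row (add (tri (tshift s)) (tshift x))) (tshift s))))
    (fun t => by simp [inst_eq, Fml.subst, term_subst_subst]) ?_ (fun x => ?_) x
  · refine all_intro fun y => ?_
    simp only [inst_eq, Fml.subst, var_subst, ap1_subst, ap2_subst, scons_zero, tshift_scons_var]
    exact impI (eq_trans (ap1_congr _ (add_zero _)) hs.wk)
  · refine all_intro fun y => ?_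
    simp only [inst_eq, Fml.subst, var_subst, ap1_subst, ap2_subst, succT_subst, scons_zero,
      tshift_scons_var]
    refine impI ?_
    have h1 := allE (succT y) (T := HA) (Γ := eq (add (succT x) y) s ::
      all (imp (eq (add (tshift x) (var 0)) (tshift s))
      (eq (row (add (tri (tshift s)) (tshift x))) (tshift s))) :: Γ) hyp1
    simp only [inst_eq, Fml.subst, var_subst, ap1_subst, ap2_subst, scons_zero,
      tshift_scons_var] at h1
    have h2 : Deriv HA (eq (add (succT x) y) s ::
      all (imp (eq (add (tshift x) (var 0)) (tshift s))
      (eq (row (add (tri (tshift s)) (tshift x))) (tshift s))) :: Γ) (eq (add x (succT y)) s) :=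
      eq_trans (add_succ x y) (eq_trans (eq_symm (succ_add x y)) hyp0)
    exact eq_trans (ap1_congr _ (add_succ _ _))
      (eq_trans (row_succ_add (impE h1 h2) h2) (succ_cond _ _))

theorem row_add {s x y : Tm} (hs : Deriv HA Γ (eq (row (tri s)) s))
    (h : Deriv HA Γ (eq (add x y) s)) : Deriv HA Γ (eq (row (add (tri s) x)) s) := by
  have h1 := allE y (row_add_aux hs x)
  simp only [inst_eq, Fml.subst, var_subst, ap1_subst, ap2_subst, scons_zero,
    tshift_scons_var] at h1
  exact impE h1 h

theorem row_tri (s : Tm) : Deriv HA Γ (eq (row (tri s)) s) :=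
  ind (eq (row (tri (var 0))) (var 0)) (fun s => eq (row (tri s)) s)
    (fun t => by simp [inst_eq, Fml.subst])
    (eq_trans (ap1_congr _ tri_zero) row_zero)
    (fun s => eq_trans (ap1_congr _ (tri_succ s))
      (eq_trans (row_succ_add (row_add hyp0 (add_zero s)) (add_zero s)) (zero_cond s))) s

/-- The code of a pair. -/
def pair (x y : Tm) : Tm := add (tri (add x y)) x
/-- The first component. -/
def fst (z : Tm) : Tm := mon (tri (row z)) z
/-- The second component. -/
def snd (z : Tm) : Tm := mon (fst z) (row z)

theorem row_pair (x y : Tm) : Deriv HA Γ (eq (row (pair x y)) (add x y)) :=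
  row_add (row_tri _) (eq_refl _)

theorem fst_pair (x y : Tm) : Deriv HA Γ (eq (fst (pair x y)) x) :=
  eq_trans (ap2_congr _ (ap1_congr _ (row_pair x y)) (eq_refl _)) (mon_add _ _)

theorem snd_pair (x y : Tm) : Deriv HA Γ (eq (snd (pair x y)) y) :=
  eq_trans (ap2_congr _ (fst_pair x y) (row_pair x y)) (mon_add _ _)

theorem fst_congr {z w : Tm} (h : Deriv HA Γ (eq z w)) : Deriv HA Γ (eq (fst z) (fst w)) :=
  ap2_congr _ (ap1_congr _ (ap1_congr _ h)) h

theorem snd_congr {z w : Tm} (h : Deriv HA Γ (eq z w)) : Deriv HA Γ (eq (snd z) (snd w)) :=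
  ap2_congr _ (fst_congr h) (ap1_congr _ h)

/-- The `i`-th component of a coded list. -/
def nth : ℕ → Tm → Tm
  | 0, z => fst z
  | i + 1, z => nth i (snd z)

/-- The code of a list of `n` terms. -/
def code : ℕ → (ℕ → Tm) → Tm
  | 0, _ => zeroT
  | n + 1, x => pair (x 0) (code n fun i => x (i + 1))

theorem nth_congr (i : ℕ) {z w : Tm} (h : Deriv HA Γ (eq z w)) :
    Deriv HA Γ (eq (nth i z) (nth i w)) := by
  induction i generalizing z w with
  | zero => exact fst_congr h
  | succ i ih => exact ih (snd_congr h)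

theorem nth_code {n i : ℕ} (hi : i < n) (x : ℕ → Tm) : Deriv HA Γ (eq (nth i (code n x)) (x i)) := by
  induction n generalizing i x with
  | zero => omega
  | succ n ih =>
    cases i with
    | zero => exact fst_pair _ _
    | succ i =>
      exact eq_trans (nth_congr i (snd_pair _ _)) (ih (by omega) fun i => x (i + 1))

theorem nth_subst (i : ℕ) (z : Tm) (σ : ℕ → Tm) : (nth i z).subst σ = nth i (z.subst σ) := by
  induction i generalizing z with
  | zero => simp [nth, fst]
  | succ i ih => simp [nth, ih, snd, fst]

theorem varFinset_nth (i : ℕ) (z : Tm) : (nth i z).varFinset ⊆ z.varFinset := by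
  have hfst (z : Tm) : (fst z).varFinset ⊆ z.varFinset := by
    intro n hn
    simpa [fst, app, FirstOrder.Language.Term.varFinset, Fin.exists_fin_two] using hn
  have hsnd (z : Tm) : (snd z).varFinset ⊆ z.varFinset := by
    intro n hn
    simp [snd, app, FirstOrder.Language.Term.varFinset, Fin.exists_fin_two] at hn
    exact hn.elim (fun h => hfst z h) id
  induction i generalizing z with
  | zero => exact hfst z
  | succ i ih => exact (ih _).trans (hsnd z)

end HA

-- Reduction of several parameters to one variable

variable {T : Set Fml}

/-- `T` contains Heyting arithmetic. -/
def ExtHA (T : Set Fml) : Prop := ∀ φ ∈ HA, Proves T φ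

theorem ExtHA.deriv (hT : ExtHA T) {Γ : List Fml} {φ : Fml} (h : Deriv HA Γ φ) : Deriv T Γ φ :=
  h.mono hT

/-- A formula is provable if its instance with coded parameters is. -/
theorem ExtHA.proves_of_coded (hT : ExtHA T) {φ : Fml}
    (h : Proves T (subst (fun i => HA.nth i (var 0)) φ)) : Proves T φ := by
  obtain ⟨n, hn⟩ := exists_fv_bound φ
  -- The single variable is instantiated with the code of all variables below `n`, whose components
  -- are provably these variables again.
  have h1 := proves_subst h (scons (HA.code n var) var)
  rw [subst_subst] at h1
  simp only [HA.nth_subst, var_subst, scons_zero] at h1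
  have h2 : Deriv HA [subst (fun i => HA.nth i (HA.code n var)) φ] φ := by
    have := HA.replace (Γ := [subst (fun i => HA.nth i (HA.code n var)) φ]) hn (τ := var)
      (fun i hi => HA.nth_code hi var) hyp0
    rwa [subst_var] at this
  exact cut h1 (hT.deriv h2)

theorem fv_coded (φ : Fml) : fv (subst (fun i => HA.nth i (var 0)) φ) ⊆ {0} := by
  intro m hm
  obtain ⟨n, -, hm⟩ := (mem_fv_subst _ _ _).1 hm
  simpa [FirstOrder.Language.Term.varFinset] using HA.varFinset_nth n _ hm

/-! ### Provable equivalence -/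

/-- Provable equivalence in `T`. -/
def Eqv (T : Set Fml) (φ ψ : Fml) : Prop := Proves T (iff φ ψ)

namespace Eqv

theorem mp {φ ψ : Fml} (h : Eqv T φ ψ) {Γ : List Fml} (h' : Deriv T Γ φ) : Deriv T Γ ψ :=
  impE (andE₁ (of_proves h)) h'

theorem mpr {φ ψ : Fml} (h : Eqv T φ ψ) {Γ : List Fml} (h' : Deriv T Γ ψ) : Deriv T Γ φ :=
  impE (andE₂ (of_proves h)) h'

theorem intro {φ ψ : Fml} (h : Deriv T [φ] ψ) (h' : Deriv T [ψ] φ) : Eqv T φ ψ :=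
  andI (impI h) (impI h')

theorem refl (φ : Fml) : Eqv T φ φ := intro hyp0 hyp0

theorem symm {φ ψ : Fml} (h : Eqv T φ ψ) : Eqv T ψ φ := intro (h.mpr hyp0) (h.mp hyp0)

theorem trans {φ ψ χ : Fml} (h : Eqv T φ ψ) (h' : Eqv T ψ χ) : Eqv T φ χ :=
  intro (h'.mp (h.mp hyp0)) (h.mpr (h'.mpr hyp0))

theorem subst {φ ψ : Fml} (h : Eqv T φ ψ) (σ : ℕ → Tm) :
    Eqv T (Fml.subst σ φ) (Fml.subst σ ψ) := proves_subst h σ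

theorem inst {φ ψ : Fml} (h : Eqv T φ ψ) (t : Tm) : Eqv T (Fml.inst φ t) (Fml.inst ψ t) :=
  h.subst _

theorem and {φ ψ φ' ψ' : Fml} (h : Eqv T φ φ') (h' : Eqv T ψ ψ') :
    Eqv T (Fml.and φ ψ) (Fml.and φ' ψ') :=
  intro (andI (h.mp (andE₁ hyp0)) (h'.mp (andE₂ hyp0)))
    (andI (h.mpr (andE₁ hyp0)) (h'.mpr (andE₂ hyp0)))

theorem or {φ ψ φ' ψ' : Fml} (h : Eqv T φ φ') (h' : Eqv T ψ ψ') :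
    Eqv T (Fml.or φ ψ) (Fml.or φ' ψ') :=
  intro (orE hyp0 (orI₁ (h.mp hyp0)) (orI₂ (h'.mp hyp0)))
    (orE hyp0 (orI₁ (h.mpr hyp0)) (orI₂ (h'.mpr hyp0)))

theorem imp {φ ψ φ' ψ' : Fml} (h : Eqv T φ φ') (h' : Eqv T ψ ψ') :
    Eqv T (Fml.imp φ ψ) (Fml.imp φ' ψ') :=
  intro (impI (h'.mp (impE hyp1 (h.mpr hyp0)))) (impI (h'.mpr (impE hyp1 (h.mp hyp0))))

theorem neg {φ φ' : Fml} (h : Eqv T φ φ') : Eqv T (Fml.neg φ) (Fml.neg φ') := h.imp (refl _)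

theorem all {φ φ' : Fml} (h : Eqv T φ φ') : Eqv T (Fml.all φ) (Fml.all φ') :=
  intro (all_intro fun t => (h.inst t).mp (allE t hyp0))
    (all_intro fun t => (h.inst t).mpr (allE t hyp0))

theorem ex {φ φ' : Fml} (h : Eqv T φ φ') : Eqv T (Fml.ex φ) (Fml.ex φ') :=
  intro (ex_elim hyp0 fun t => exI t ((h.inst t).mp hyp0))
    (ex_elim hyp0 fun t => exI t ((h.inst t).mpr hyp0))

-- Quantifier shifts valid intuitionistically

theorem ex_and (φ ψ : Fml) :
    Eqv T (Fml.and (Fml.ex φ) ψ) (Fml.ex (Fml.and φ (shift ψ))) := by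
  refine intro (ex_elim (andE₁ hyp0) fun t => exI t ?_) (ex_elim hyp0 fun t => ?_)
  · exact andI hyp0 (show Deriv T _ (Fml.inst (shift ψ) t) by rw [inst_shift]; exact andE₂ hyp1)
  · have h : Deriv T [Fml.inst (Fml.and φ (shift ψ)) t, Fml.ex (Fml.and φ (shift ψ))]
      (Fml.and (Fml.inst φ t) (Fml.inst (shift ψ) t)) := hyp0
    rw [inst_shift] at h
    exact andI (exI t (andE₁ h)) (andE₂ h)

theorem all_and (φ ψ : Fml) :
    Eqv T (Fml.and (Fml.all φ) ψ) (Fml.all (Fml.and φ (shift ψ))) := by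
  have h (t) : Deriv T [Fml.all (Fml.and φ (shift ψ))]
      (Fml.and (Fml.inst φ t) (Fml.inst (shift ψ) t)) := allE t hyp0
  refine intro (all_intro fun t => ?_) (andI (all_intro fun t => andE₁ (h t)) ?_)
  · exact andI (allE t (andE₁ hyp0)) (show Deriv T _ (Fml.inst (shift ψ) t) by rw [inst_shift]; exact andE₂ hyp0)
  · have := andE₂ (h zeroT)
    rwa [inst_shift] at this

theorem and_comm (φ ψ : Fml) : Eqv T (Fml.and φ ψ) (Fml.and ψ φ) :=
  intro (andI (andE₂ hyp0) (andE₁ hyp0)) (andI (andE₂ hyp0) (andE₁ hyp0))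

theorem and_ex (φ ψ : Fml) : Eqv T (Fml.and φ (Fml.ex ψ)) (Fml.ex (Fml.and (shift φ) ψ)) :=
  (and_comm _ _).trans ((ex_and _ _).trans (and_comm _ _).ex)

theorem and_all (φ ψ : Fml) : Eqv T (Fml.and φ (Fml.all ψ)) (Fml.all (Fml.and (shift φ) ψ)) :=
  (and_comm _ _).trans ((all_and _ _).trans (and_comm _ _).all)

theorem ex_shift (φ : Fml) : Eqv T φ (Fml.ex (shift φ)) :=
  intro (exI zeroT (by rw [inst_shift]; exact hyp0))
    (ex_elim hyp0 fun t => by rw [inst_shift]; exact hyp0)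

theorem all_shift (φ : Fml) : Eqv T φ (Fml.all (shift φ)) :=
  intro (all_intro fun t => by rw [inst_shift]; exact hyp0)
    (by have := allE (T := T) zeroT (hyp0 (φ := Fml.all (shift φ)) (Γ := [])); rwa [inst_shift] at this)

theorem imp_all (φ ψ : Fml) :
    Eqv T (Fml.imp φ (Fml.all ψ)) (Fml.all (Fml.imp (shift φ) ψ)) := by
  refine intro (all_intro fun t => ?_) (impI (all_intro fun t => ?_))
  · show Deriv T _ (Fml.imp (Fml.inst (shift φ) t) (Fml.inst ψ t))
    rw [inst_shift]
    exact impI (allE t (impE hyp1 hyp0))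
  · have h : Deriv T [φ, Fml.all (Fml.imp (shift φ) ψ)]
      (Fml.imp (Fml.inst (shift φ) t) (Fml.inst ψ t)) := allE t hyp1
    rw [inst_shift] at h
    exact impE h hyp0

theorem ex_imp (φ ψ : Fml) :
    Eqv T (Fml.imp (Fml.ex φ) ψ) (Fml.all (Fml.imp φ (shift ψ))) := by
  refine intro (all_intro fun t => ?_) (impI (ex_elim hyp0 fun t => ?_))
  · show Deriv T _ (Fml.imp (Fml.inst φ t) (Fml.inst (shift ψ) t))
    rw [inst_shift]
    exact impI (impE hyp1 (exI t hyp0))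
  · have h : Deriv T [Fml.inst φ t, Fml.ex φ, Fml.all (Fml.imp φ (shift ψ))]
      (Fml.imp (Fml.inst φ t) (Fml.inst (shift ψ) t)) := allE t hyp2
    rw [inst_shift] at h
    exact impE h hyp0

theorem neg_ex (φ : Fml) : Eqv T (Fml.neg (Fml.ex φ)) (Fml.all (Fml.neg φ)) := ex_imp φ bot

/-- A decidable premise commutes with an existential quantifier. -/
theorem imp_ex {φ : Fml} (h : Proves T (Fml.or φ (Fml.neg φ))) (ψ : Fml) :
    Eqv T (Fml.imp φ (Fml.ex ψ)) (Fml.ex (Fml.imp (shift φ) ψ)) := by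
  have hinst (t : Tm) : Fml.inst (Fml.imp (shift φ) ψ) t = Fml.imp φ (Fml.inst ψ t) := by
    show Fml.imp (Fml.inst (shift φ) t) (Fml.inst ψ t) = _
    rw [inst_shift]
  refine intro (orE (of_proves h) (ex_elim (impE hyp1 hyp0) fun t => exI t ?_) (exI zeroT ?_))
    (ex_elim hyp0 fun t => ?_)
  · rw [hinst]; exact impI hyp1
  · rw [hinst]; exact impI (botE (impE hyp1 hyp0))
  · rw [hinst]; exact impI (exI t (impE hyp1 hyp0))

end Eqv

/-! ### Prenex classes -/

theorem Fml.QF.subst {φ : Fml} (h : QF φ) (σ : ℕ → Tm) : QF (Fml.subst σ φ) := by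
  induction φ with
  | eq t s => trivial
  | bot => trivial
  | and φ ψ ih₁ ih₂ | or φ ψ ih₁ ih₂ | imp φ ψ ih₁ ih₂ => exact ⟨ih₁ h.1, ih₂ h.2⟩
  | all φ => exact h.elim
  | ex φ => exact h.elim

theorem mem_sigma_zero {φ : Fml} : φ ∈ SigmaClass 0 ↔ QF φ := by rw [SigmaClass]; rfl
theorem mem_pi_zero {φ : Fml} : φ ∈ PiClass 0 ↔ QF φ := by rw [PiClass]; rfl
theorem mem_sigma_succ {k : ℕ} {φ : Fml} :
    φ ∈ SigmaClass (k + 1) ↔ ∃ n, ∃ ψ ∈ PiClass k, φ = exs n ψ := by rw [SigmaClass]; rfl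
theorem mem_pi_succ {k : ℕ} {φ : Fml} :
    φ ∈ PiClass (k + 1) ↔ ∃ n, ∃ ψ ∈ SigmaClass k, φ = alls n ψ := by rw [PiClass]; rfl

theorem sigma_of_pi {k : ℕ} {φ : Fml} (h : φ ∈ PiClass k) : φ ∈ SigmaClass (k + 1) :=
  mem_sigma_succ.2 ⟨0, φ, h, rfl⟩

theorem pi_of_sigma {k : ℕ} {φ : Fml} (h : φ ∈ SigmaClass k) : φ ∈ PiClass (k + 1) :=
  mem_pi_succ.2 ⟨0, φ, h, rfl⟩

theorem sigma_ex {k : ℕ} {φ : Fml} (h : φ ∈ SigmaClass (k + 1)) : ex φ ∈ SigmaClass (k + 1) := by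
  obtain ⟨n, ψ, hψ, rfl⟩ := mem_sigma_succ.1 h
  exact mem_sigma_succ.2 ⟨n + 1, ψ, hψ, rfl⟩

theorem pi_all {k : ℕ} {φ : Fml} (h : φ ∈ PiClass (k + 1)) : all φ ∈ PiClass (k + 1) := by
  obtain ⟨n, ψ, hψ, rfl⟩ := mem_pi_succ.1 h
  exact mem_pi_succ.2 ⟨n + 1, ψ, hψ, rfl⟩

/-- Induction along the leading block of a `Σ` formula. -/
theorem sigma_rec {k : ℕ} {P : Fml → Prop} (base : ∀ φ ∈ PiClass k, P φ)
    (step : ∀ φ ∈ SigmaClass (k + 1), P φ → P (ex φ)) {φ : Fml} (h : φ ∈ SigmaClass (k + 1)) :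
    P φ := by
  obtain ⟨n, ψ, hψ, rfl⟩ := mem_sigma_succ.1 h
  clear h
  induction n with
  | zero => exact base ψ hψ
  | succ n ih => exact step _ (mem_sigma_succ.2 ⟨n, ψ, hψ, rfl⟩) ih

/-- Induction along the leading block of a `Π` formula. -/
theorem pi_rec {k : ℕ} {P : Fml → Prop} (base : ∀ φ ∈ SigmaClass k, P φ)
    (step : ∀ φ ∈ PiClass (k + 1), P φ → P (all φ)) {φ : Fml} (h : φ ∈ PiClass (k + 1)) :
    P φ := by
  obtain ⟨n, ψ, hψ, rfl⟩ := mem_pi_succ.1 h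
  clear h
  induction n with
  | zero => exact base ψ hψ
  | succ n ih => exact step _ (mem_pi_succ.2 ⟨n, ψ, hψ, rfl⟩) ih

theorem class_succ (k : ℕ) :
    (∀ φ ∈ SigmaClass k, φ ∈ SigmaClass (k + 1)) ∧ (∀ φ ∈ PiClass k, φ ∈ PiClass (k + 1)) := by
  induction k with
  | zero =>
    exact ⟨fun φ h => sigma_of_pi (mem_pi_zero.2 (mem_sigma_zero.1 h)),
      fun φ h => pi_of_sigma (mem_sigma_zero.2 (mem_pi_zero.1 h))⟩
  | succ k ih =>
    exact ⟨fun φ => sigma_rec (fun ψ h => sigma_of_pi (ih.2 ψ h)) fun ψ _ h => sigma_ex h,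
      fun φ => pi_rec (fun ψ h => pi_of_sigma (ih.1 ψ h)) fun ψ _ h => pi_all h⟩

theorem sigma_mono {j k : ℕ} (h : j ≤ k) {φ : Fml} (hφ : φ ∈ SigmaClass j) : φ ∈ SigmaClass k := by
  induction h with
  | refl => exact hφ
  | step _ ih => exact (class_succ _).1 _ ih

theorem pi_mono {j k : ℕ} (h : j ≤ k) {φ : Fml} (hφ : φ ∈ PiClass j) : φ ∈ PiClass k := by
  induction h with
  | refl => exact hφ
  | step _ ih => exact (class_succ _).2 _ ih

theorem class_of_qf {φ : Fml} (h : QF φ) (k : ℕ) : φ ∈ SigmaClass k ∧ φ ∈ PiClass k :=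
  ⟨sigma_mono k.zero_le (mem_sigma_zero.2 h), pi_mono k.zero_le (mem_pi_zero.2 h)⟩

theorem class_subst (k : ℕ) : (∀ φ ∈ SigmaClass k, ∀ σ, subst σ φ ∈ SigmaClass k) ∧
    (∀ φ ∈ PiClass k, ∀ σ, subst σ φ ∈ PiClass k) := by
  induction k with
  | zero =>
    exact ⟨fun φ h σ => mem_sigma_zero.2 (Fml.QF.subst (mem_sigma_zero.1 h) σ),
      fun φ h σ => mem_pi_zero.2 (Fml.QF.subst (mem_pi_zero.1 h) σ)⟩
  | succ k ih =>
    exact ⟨fun φ => sigma_rec (fun ψ h σ => sigma_of_pi (ih.2 ψ h σ))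
        fun ψ _ h σ => sigma_ex (h (up σ)),
      fun φ => pi_rec (fun ψ h σ => pi_of_sigma (ih.1 ψ h σ)) fun ψ _ h σ => pi_all (h (up σ))⟩

/-- `φ` is provably equivalent to a `Σ_k` formula. -/
def SigT (T : Set Fml) (k : ℕ) (φ : Fml) : Prop := ∃ ψ ∈ SigmaClass k, Eqv T φ ψ

/-- `φ` is provably equivalent to a `Π_k` formula. -/
def PiT (T : Set Fml) (k : ℕ) (φ : Fml) : Prop := ∃ ψ ∈ PiClass k, Eqv T φ ψ

theorem SigT.of_mem {k : ℕ} {φ : Fml} (h : φ ∈ SigmaClass k) : SigT T k φ := ⟨φ, h, .refl _⟩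
theorem PiT.of_mem {k : ℕ} {φ : Fml} (h : φ ∈ PiClass k) : PiT T k φ := ⟨φ, h, .refl _⟩

theorem SigT.eqv {k : ℕ} {φ ψ : Fml} (h : SigT T k φ) (e : Eqv T ψ φ) : SigT T k ψ :=
  let ⟨χ, hχ, e'⟩ := h; ⟨χ, hχ, e.trans e'⟩
theorem PiT.eqv {k : ℕ} {φ ψ : Fml} (h : PiT T k φ) (e : Eqv T ψ φ) : PiT T k ψ :=
  let ⟨χ, hχ, e'⟩ := h; ⟨χ, hχ, e.trans e'⟩

theorem SigT.of_pi {k : ℕ} {φ : Fml} (h : PiT T k φ) : SigT T (k + 1) φ :=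
  let ⟨χ, hχ, e⟩ := h; ⟨χ, sigma_of_pi hχ, e⟩
theorem PiT.of_sigma {k : ℕ} {φ : Fml} (h : SigT T k φ) : PiT T (k + 1) φ :=
  let ⟨χ, hχ, e⟩ := h; ⟨χ, pi_of_sigma hχ, e⟩

theorem SigT.of_qf {k : ℕ} {φ : Fml} (h : QF φ) : SigT T k φ := .of_mem (class_of_qf h k).1
theorem PiT.of_qf {k : ℕ} {φ : Fml} (h : QF φ) : PiT T k φ := .of_mem (class_of_qf h k).2

theorem SigT.ex {k : ℕ} {φ : Fml} (h : SigT T (k + 1) φ) : SigT T (k + 1) (Fml.ex φ) :=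
  let ⟨_, hχ, e⟩ := h; ⟨_, sigma_ex hχ, e.ex⟩
theorem PiT.all {k : ℕ} {φ : Fml} (h : PiT T (k + 1) φ) : PiT T (k + 1) (Fml.all φ) :=
  let ⟨_, hχ, e⟩ := h; ⟨_, pi_all hχ, e.all⟩

theorem SigT.subst {k : ℕ} {φ : Fml} (h : SigT T k φ) (σ : ℕ → Tm) : SigT T k (Fml.subst σ φ) :=
  let ⟨_, hχ, e⟩ := h; ⟨_, (class_subst k).1 _ hχ σ, e.subst σ⟩
theorem PiT.subst {k : ℕ} {φ : Fml} (h : PiT T k φ) (σ : ℕ → Tm) : PiT T k (Fml.subst σ φ) :=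
  let ⟨_, hχ, e⟩ := h; ⟨_, (class_subst k).2 _ hχ σ, e.subst σ⟩

/-- Induction along the leading block, up to provable equivalence. -/
theorem SigT.rec_on {k : ℕ} (P : Fml → Prop) (eqv : ∀ φ ψ, Eqv T φ ψ → P ψ → P φ)
    (base : ∀ φ, PiT T k φ → P φ) (step : ∀ φ, SigT T (k + 1) φ → P φ → P (Fml.ex φ)) {φ : Fml}
    (h : SigT T (k + 1) φ) : P φ := by
  obtain ⟨ψ, hψ, e⟩ := h
  exact eqv _ _ e (sigma_rec (fun χ h => base χ (.of_mem h)) (fun χ h => step χ (.of_mem h)) hψ)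

/-- Induction along the leading block, up to provable equivalence. -/
theorem PiT.rec_on {k : ℕ} (P : Fml → Prop) (eqv : ∀ φ ψ, Eqv T φ ψ → P ψ → P φ)
    (base : ∀ φ, SigT T k φ → P φ) (step : ∀ φ, PiT T (k + 1) φ → P φ → P (Fml.all φ)) {φ : Fml}
    (h : PiT T (k + 1) φ) : P φ := by
  obtain ⟨ψ, hψ, e⟩ := h
  exact eqv _ _ e (pi_rec (fun χ h => base χ (.of_mem h)) (fun χ h => step χ (.of_mem h)) hψ)

theorem SigT.zero_iff {φ : Fml} : SigT T 0 φ ↔ PiT T 0 φ := by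
  simp only [SigT, PiT, mem_sigma_zero, mem_pi_zero]

/-- No DNE is needed: the leading block of one conjunct is pulled out, then that of the other, and
the bodies form a conjunction one level lower. -/
theorem and_closure (k : ℕ) :
    (∀ φ ψ, SigT T k φ → SigT T k ψ → SigT T k (and φ ψ)) ∧
    (∀ φ ψ, PiT T k φ → PiT T k ψ → PiT T k (and φ ψ)) := by
  induction k with
  | zero =>
    have : ∀ φ ψ, SigT T 0 φ → SigT T 0 ψ → SigT T 0 (and φ ψ) := by
      rintro φ ψ ⟨φ', h, e⟩ ⟨ψ', h', e'⟩
      exact ⟨and φ' ψ', mem_sigma_zero.2 ⟨mem_sigma_zero.1 h, mem_sigma_zero.1 h'⟩, e.and e'⟩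
    exact ⟨this, by simpa only [SigT.zero_iff] using this⟩
  | succ k ih =>
    constructor
    · intro φ ψ hφ
      revert ψ
      refine SigT.rec_on (fun φ => ∀ ψ, SigT T (k + 1) ψ → SigT T (k + 1) (Fml.and φ ψ))
        (fun φ _ e h ψ hψ => (h ψ hψ).eqv (e.and (.refl _))) (fun φ hφ ψ hψ => ?_)
        (fun φ _ ih ψ hψ => (ih _ (hψ.subst _)).ex.eqv (.ex_and φ ψ)) hφ
      revert φ
      refine SigT.rec_on (fun ψ => ∀ φ, PiT T k φ → SigT T (k + 1) (Fml.and φ ψ))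
        (fun φ _ e h ψ hψ => (h ψ hψ).eqv ((Eqv.refl _).and e))
        (fun φ hφ ψ hψ => .of_pi (ih.2 _ _ hψ hφ))
        (fun φ _ ih ψ hψ => (ih _ (hψ.subst _)).ex.eqv (.and_ex ψ φ)) hψ
    · intro φ ψ hφ
      revert ψ
      refine PiT.rec_on (fun φ => ∀ ψ, PiT T (k + 1) ψ → PiT T (k + 1) (Fml.and φ ψ))
        (fun φ _ e h ψ hψ => (h ψ hψ).eqv (e.and (.refl _))) (fun φ hφ ψ hψ => ?_)
        (fun φ _ ih ψ hψ => (ih _ (hψ.subst _)).all.eqv (.all_and φ ψ)) hφ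
      revert φ
      refine PiT.rec_on (fun ψ => ∀ φ, SigT T k φ → PiT T (k + 1) (Fml.and φ ψ))
        (fun φ _ e h ψ hψ => (h ψ hψ).eqv ((Eqv.refl _).and e))
        (fun φ hφ ψ hψ => .of_sigma (ih.1 _ _ hψ hφ))
        (fun φ _ ih ψ hψ => (ih _ (hψ.subst _)).all.eqv (.and_all ψ φ)) hψ

theorem SigT.and {k : ℕ} {φ ψ : Fml} (h : SigT T k φ) (h' : SigT T k ψ) :
    SigT T k (Fml.and φ ψ) := (and_closure k).1 _ _ h h'

theorem PiT.and {k : ℕ} {φ ψ : Fml} (h : PiT T k φ) (h' : PiT T k ψ) :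
    PiT T k (Fml.and φ ψ) := (and_closure k).2 _ _ h h'

/-- A quantifier-free premise is decidable in `HA`, so even `∃` can be pulled over it. -/
theorem qf_imp_closure (hT : ExtHA T) (k : ℕ) :
    (∀ φ ψ, SigT T k ψ → QF φ → SigT T k (imp φ ψ)) ∧
    (∀ φ ψ, PiT T k ψ → QF φ → PiT T k (imp φ ψ)) := by
  induction k with
  | zero =>
    have : ∀ φ ψ, SigT T 0 ψ → QF φ → SigT T 0 (imp φ ψ) := by
      rintro φ ψ ⟨ψ', h', e'⟩ h
      exact ⟨imp φ ψ', mem_sigma_zero.2 ⟨h, mem_sigma_zero.1 h'⟩, (Eqv.refl _).imp e'⟩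
    exact ⟨this, by simpa only [SigT.zero_iff] using this⟩
  | succ k ih =>
    constructor
    · intro φ ψ hψ
      revert φ
      exact SigT.rec_on (fun ψ => ∀ φ, QF φ → SigT T (k + 1) (Fml.imp φ ψ)) (fun ψ _ e h φ hφ => (h φ hφ).eqv ((Eqv.refl _).imp e))
        (fun ψ hψ φ hφ => .of_pi (ih.2 _ _ hψ hφ))
        (fun ψ _ ih φ hφ => (ih _ (hφ.subst _)).ex.eqv
          (.imp_ex (hT.deriv (HA.qf_dec hφ)) ψ)) hψ
    · intro φ ψ hψ
      revert φ
      exact PiT.rec_on (fun ψ => ∀ φ, QF φ → PiT T (k + 1) (Fml.imp φ ψ)) (fun ψ _ e h φ hφ => (h φ hφ).eqv ((Eqv.refl _).imp e))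
        (fun ψ hψ φ hφ => .of_sigma (ih.1 _ _ hψ hφ))
        (fun ψ _ ih φ hφ => (ih _ (hφ.subst _)).all.eqv (.imp_all φ ψ)) hψ

/-- Trades `∨` for an existential quantifier over a case marker. Thus `Σ_{k+1}` is closed under `∨`
without pulling a universal quantifier out of a disjunction. -/
theorem or_eqv_ex (hT : ExtHA T) (φ ψ : Fml) : Eqv T (or φ ψ)
    (ex (and (imp (eq (var 0) zeroT) (shift φ)) (imp (neg (eq (var 0) zeroT)) (shift ψ)))) := by
  have hinst (t : Tm) : inst (and (imp (eq (var 0) zeroT) (shift φ))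
      (imp (neg (eq (var 0) zeroT)) (shift ψ))) t =
      and (imp (eq t zeroT) φ) (imp (neg (eq t zeroT)) ψ) := by
    have h1 := inst_shift φ t
    have h2 := inst_shift ψ t
    rw [inst_eq] at h1 h2
    simp [inst_eq, Fml.subst, h1, h2]
  refine .intro (orE hyp0 (exI zeroT ?_) (exI (succT zeroT) ?_)) (ex_elim hyp0 fun t => ?_)
  · rw [hinst]
    exact andI (impI hyp1) (impI (botE (impE hyp0 (hT.deriv (HA.eq_refl _)))))
  · rw [hinst]
    exact andI (impI (botE (impE (hT.deriv (HA.ax (.succNeZero _))) hyp0))) (impI hyp1)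
  · rw [hinst]
    exact orE (hT.deriv (HA.eq_dec t zeroT)) (orI₁ (impE (andE₁ hyp1) hyp0))
      (orI₂ (impE (andE₂ hyp1) hyp0))

theorem SigT.or (hT : ExtHA T) {k : ℕ} {φ ψ : Fml} (h : SigT T k φ) (h' : SigT T k ψ) :
    SigT T k (Fml.or φ ψ) := by
  cases k with
  | zero =>
    obtain ⟨φ', h, e⟩ := h
    obtain ⟨ψ', h', e'⟩ := h'
    exact ⟨Fml.or φ' ψ', mem_sigma_zero.2 ⟨mem_sigma_zero.1 h, mem_sigma_zero.1 h'⟩, e.or e'⟩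
  | succ k =>
    refine SigT.eqv (SigT.ex (SigT.and ?_ ?_)) (or_eqv_ex hT φ ψ)
    · exact (qf_imp_closure hT _).1 _ _ (h.subst _) trivial
    · exact (qf_imp_closure hT _).1 _ _ (h'.subst _) ⟨trivial, trivial⟩

/-! ### Stability and duality -/

/-- `T` proves `¬¬φ → φ`. -/
def Stable (T : Set Fml) (φ : Fml) : Prop := Proves T (imp (neg (neg φ)) φ)

/-- `T` proves double negation elimination, with parameters, for all `Σ_j` with `j < k`. -/
def Stab (T : Set Fml) (k : ℕ) : Prop := ∀ j < k, ∀ φ ∈ SigmaClass j, Stable T φ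

theorem Stable.apply {φ : Fml} (h : Stable T φ) {Γ : List Fml} (h' : Deriv T (neg φ :: Γ) bot) :
    Deriv T Γ φ := impE (of_proves h) (impI h')

theorem Stable.subst {φ : Fml} (h : Stable T φ) (σ : ℕ → Tm) : Stable T (Fml.subst σ φ) :=
  proves_subst h σ

theorem Stable.inst {φ : Fml} (h : Stable T φ) (t : Tm) : Stable T (Fml.inst φ t) := h.subst _

theorem Stable.eqv {φ ψ : Fml} (h : Stable T φ) (e : Eqv T ψ φ) : Stable T ψ :=
  impI (e.mpr (h.apply (impE hyp1 (impI (impE hyp1 (e.mp hyp0))))))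

theorem Stable.all {φ : Fml} (h : Stable T φ) : Stable T (Fml.all φ) :=
  impI (all_intro fun t => (h.inst t).apply
    (impE hyp1 (impI (impE hyp1 (allE t hyp0)))))

theorem Stable.of_dec {φ : Fml} (h : Proves T (or φ (neg φ))) : Stable T φ :=
  impE (taut [φ] ((x₀ ⊔ x₀ᶜ) ⇨ x₀ᶜᶜ ⇨ x₀) rfl) h

theorem Stab.mono {j k : ℕ} (h : Stab T k) (hjk : j ≤ k) : Stab T j :=
  fun i hi => h i (hi.trans_le hjk)

theorem SigT.stable {k : ℕ} {φ : Fml} (hφ : SigT T k φ) (h : Stab T (k + 1)) : Stable T φ :=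
  let ⟨_, hψ, e⟩ := hφ; (h k k.lt_succ_self _ hψ).eqv e

/-- Stability passes through `∀`, so a `Π_k` formula needs DNE only for the levels strictly below
`k`. -/
theorem PiT.stable (hT : ExtHA T) {k : ℕ} {φ : Fml} (hφ : PiT T k φ) (h : Stab T k) :
    Stable T φ := by
  cases k with
  | zero =>
    obtain ⟨ψ, hψ, e⟩ := hφ
    exact (Stable.of_dec (hT.deriv (HA.qf_dec (mem_pi_zero.1 hψ)))).eqv e
  | succ k =>
    exact PiT.rec_on (Stable T) (fun _ _ e h => h.eqv e) (fun _ hφ => hφ.stable h)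
      (fun _ _ ih => ih.all) hφ

theorem Eqv.neg_all {φ : Fml} (h : Stable T φ) (h' : Stable T (Fml.ex (Fml.neg φ))) :
    Eqv T (Fml.neg (Fml.all φ)) (Fml.ex (Fml.neg φ)) := by
  refine .intro (h'.apply (impE hyp1 (all_intro fun t => (h.inst t).apply (impE hyp1 ?_))))
    (ex_elim hyp0 fun t => impI (impE hyp1 (allE t hyp0)))
  exact exI t hyp0

/-- The two bounds differ by one: `¬∃` is `∀¬` outright, whereas replacing `¬∀` by `∃¬` requires
stability of the resulting `Σ_k` formula itself. -/
theorem neg_closure (hT : ExtHA T) (k : ℕ) :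
    (Stab T k → ∀ φ, SigT T k φ → PiT T k (neg φ)) ∧
    (Stab T (k + 1) → ∀ φ, PiT T k φ → SigT T k (neg φ)) := by
  induction k with
  | zero =>
    have : ∀ φ, SigT T 0 φ → PiT T 0 (neg φ) := by
      rintro φ ⟨φ', h, e⟩
      exact ⟨neg φ', mem_pi_zero.2 ⟨mem_sigma_zero.1 h, trivial⟩, e.neg⟩
    exact ⟨fun _ => this, fun _ φ h => SigT.zero_iff.2 (this φ (SigT.zero_iff.2 h))⟩
  | succ k ih =>
    constructor
    · intro hS φ hφ
      exact SigT.rec_on (fun φ => PiT T (k + 1) (neg φ)) (fun _ _ e h => h.eqv e.neg)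
        (fun φ hφ => .of_sigma (ih.2 hS φ hφ)) (fun φ _ ih => ih.all.eqv (.neg_ex φ)) hφ
    · intro hS φ hφ
      have hS' : Stab T (k + 1) := hS.mono (Nat.le_succ _)
      exact PiT.rec_on (fun φ => SigT T (k + 1) (neg φ)) (fun _ _ e h => h.eqv e.neg)
        (fun φ hφ => .of_pi (ih.1 (hS'.mono (Nat.le_succ _)) φ hφ))
        (fun φ hφ ih => ih.ex.eqv (.neg_all (hφ.stable hT hS') (ih.ex.stable hS))) hφ

theorem SigT.neg (hT : ExtHA T) {k : ℕ} (hS : Stab T k) {φ : Fml} (h : SigT T k φ) :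
    PiT T k (Fml.neg φ) := (neg_closure hT k).1 hS φ h

theorem PiT.neg (hT : ExtHA T) {k : ℕ} (hS : Stab T (k + 1)) {φ : Fml} (h : PiT T k φ) :
    SigT T k (Fml.neg φ) := (neg_closure hT k).2 hS φ h

/-- Every `Π_k` formula is equivalent to the negation of a `Σ_k` formula. -/
theorem PiT.exists_neg (hT : ExtHA T) {k : ℕ} (hS : Stab T k) {φ : Fml} (h : PiT T k φ) :
    ∃ σ, SigT T k σ ∧ Eqv T (Fml.neg σ) φ := by
  have hneg {φ : Fml} (h : Stable T φ) : Eqv T (Fml.neg (Fml.neg φ)) φ :=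
    .intro (impE (of_proves h) hyp0) (impI (impE hyp0 hyp1))
  cases k with
  | zero =>
    have hs := h.stable hT hS
    obtain ⟨ψ, hψ, e⟩ := h
    exact ⟨Fml.neg φ, ⟨Fml.neg ψ, mem_sigma_zero.2 ⟨mem_pi_zero.1 hψ, trivial⟩, e.neg⟩, hneg hs⟩
  | succ k =>
    refine PiT.rec_on (fun φ => ∃ σ, SigT T (k + 1) σ ∧ Eqv T (Fml.neg σ) φ) ?_ ?_ ?_ h
    · rintro φ ψ e ⟨σ, hσ, e'⟩
      exact ⟨σ, hσ, e'.trans e.symm⟩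
    · intro φ hφ
      -- The witness is `¬φ`: as the negation of a `Σ_k` formula it is `Π_k`, hence `Σ_{k+1}`.
      -- Negating the whole `Π_{k+1}` formula would need one more level of DNE.
      exact ⟨_, .of_pi (hφ.neg hT (hS.mono (Nat.le_succ _))), hneg (hφ.stable hS)⟩
    · rintro φ - ⟨σ, hσ, e⟩
      exact ⟨_, hσ.ex, (Eqv.neg_ex σ).trans e.all⟩

/-- Classically the implication is `¬φ ∨ ψ`. This disjunction is equivalent to a `Σ_k` formula,
hence stable, and stability makes the classical equivalence provable. -/
theorem SigT.imp (hT : ExtHA T) {k : ℕ} (hS : Stab T (k + 1)) {φ ψ : Fml} (hφ : PiT T k φ)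
    (hψ : SigT T k ψ) : SigT T k (Fml.imp φ ψ) := by
  have h := (hφ.neg hT hS).or hT hψ
  refine h.eqv (.intro ?_ ?_)
  · exact impE (impE (taut [φ, ψ] (((x₀ᶜ ⊔ x₁)ᶜᶜ ⇨ x₀ᶜ ⊔ x₁) ⇨ (x₀ ⇨ x₁) ⇨ x₀ᶜ ⊔ x₁) rfl)
      (of_proves (h.stable hS))) hyp0
  · exact impE (taut [φ, ψ] (x₀ᶜ ⊔ x₁ ⇨ x₀ ⇨ x₁) rfl) hyp0

/-- The leading `∃` of the premise and the leading `∀` of the conclusion both come out as `∀`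
intuitionistically. What remains is `Π_{k-1} → Σ_{k-1}`, where `SigT.imp` costs only `Stab T k`. -/
theorem PiT.imp (hT : ExtHA T) {k : ℕ} (hS : Stab T k) {φ ψ : Fml} (hφ : SigT T k φ)
    (hψ : PiT T k ψ) : PiT T k (Fml.imp φ ψ) := by
  cases k with
  | zero =>
    obtain ⟨φ', h, e⟩ := hφ
    obtain ⟨ψ', h', e'⟩ := hψ
    exact ⟨Fml.imp φ' ψ', mem_pi_zero.2 ⟨mem_sigma_zero.1 h, mem_pi_zero.1 h'⟩, e.imp e'⟩
  | succ k =>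
    revert ψ
    exact SigT.rec_on (fun φ => ∀ {ψ}, PiT T (k + 1) ψ → PiT T (k + 1) (Fml.imp φ ψ))
      (fun _ _ e h _ hψ => (h hψ).eqv (e.imp (.refl _)))
      (fun φ hφ ψ hψ => PiT.rec_on (fun ψ => ∀ {φ}, PiT T k φ → PiT T (k + 1) (Fml.imp φ ψ))
        (fun _ _ e h _ hφ => (h hφ).eqv ((Eqv.refl _).imp e))
        (fun _ hψ _ hφ => .of_sigma (SigT.imp hT hS hφ hψ))
        (fun ψ _ ih φ hφ => (ih (hφ.subst _)).all.eqv (.imp_all φ ψ)) hψ hφ)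
      (fun φ _ ih ψ hψ => (ih (hψ.subst _)).all.eqv (.ex_imp φ ψ)) hφ

/-! ### Alternation paths -/

/-- Paths of length at most `k` such that, if the length is `k`, the first symbol is `a`. -/
def PathOK (a : Sgn) (k : ℕ) (s : List Sgn) : Prop :=
  s.length ≤ k ∧ (s.length = k → s = [] ∨ s.head? = some a)

/-- All paths of `φ` are of length at most `k`, and those of length `k` start with `a`. -/
def AltOK (a : Sgn) (k : ℕ) (φ : Fml) : Prop := ∀ s ∈ alt φ, PathOK a k s

@[simp] theorem Sgn.flip_flip (a : Sgn) : a.flip.flip = a := by cases a <;> rfl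

theorem Sgn.flip_ne (a : Sgn) : a.flip ≠ a := by cases a <;> simp [Sgn.flip]

theorem pathOK_nil (a : Sgn) (k : ℕ) : PathOK a k [] := ⟨k.zero_le, fun _ => Or.inl rfl⟩

theorem PathOK.of_flip {a : Sgn} {k : ℕ} {s : List Sgn} (h : PathOK a k (s.map Sgn.flip)) :
    PathOK a.flip k s := by
  refine ⟨by simpa using h.1, fun e => ?_⟩
  rcases h.2 (by simpa using e) with h | h
  · exact Or.inl (by simpa using h)
  · cases s with
    | nil => exact Or.inl rfl
    | cons b s => right; simp at h ⊢; rw [← h, Sgn.flip_flip]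

theorem length_extendPath (a : Sgn) (s : List Sgn) : s.length ≤ (extendPath a s).length := by
  unfold extendPath; split <;> simp

theorem head_extendPath (a : Sgn) (s : List Sgn) : (extendPath a s).head? = some a := by
  unfold extendPath; split <;> simp_all

/-- A path of full length `k` not starting with `a` would be extended to length `k + 1`. -/
theorem PathOK.of_extend {a : Sgn} {k : ℕ} {s : List Sgn} (h : PathOK a k (extendPath a s)) :
    PathOK a k s := by
  refine ⟨(length_extendPath a s).trans h.1, fun e => ?_⟩
  right
  by_contra hs
  have := h.1
  rw [extendPath, if_neg hs, List.length_cons] at this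
  omega

theorem PathOK.lt_of_extend_flip {a : Sgn} {k : ℕ} {s : List Sgn}
    (h : PathOK a k (extendPath a.flip s)) : (extendPath a.flip s).length < k := by
  refine lt_of_le_of_ne h.1 fun e => ?_
  have hh := head_extendPath a.flip s
  rcases h.2 e with h | h
  · rw [h] at hh; cases hh
  · rw [hh] at h; exact a.flip_ne (Option.some.inj h)

theorem mem_alt_imp_left {φ : Fml} (ψ : Fml) {s : List Sgn} (hs : s ∈ alt φ) :
    s.map Sgn.flip ∈ alt (imp φ ψ) := by
  have : s.map Sgn.flip ∈ (alt φ).image (List.map Sgn.flip) := Finset.mem_image_of_mem _ hs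
  cases ψ with
  | bot => exact this
  | _ => exact Finset.mem_union_left _ this

theorem alt_imp_of_ne {φ ψ : Fml} (h : ψ ≠ bot) :
    alt (imp φ ψ) = (alt φ).image (List.map Sgn.flip) ∪ alt ψ := by
  cases ψ with
  | bot => exact (h rfl).elim
  | _ => rfl

theorem AltOK.imp_left {a : Sgn} {k : ℕ} {φ ψ : Fml} (h : AltOK a k (imp φ ψ)) :
    AltOK a.flip k φ := fun _ hs => (h _ (mem_alt_imp_left ψ hs)).of_flip

/-- The special clause for negation drops the paths of `⊥`, but these are only the empty one, which
is harmless. -/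
theorem AltOK.imp_right {a : Sgn} {k : ℕ} {φ ψ : Fml} (h : AltOK a k (imp φ ψ)) :
    AltOK a k ψ := by
  intro s hs
  by_cases hψ : ψ = bot
  · subst hψ
    obtain rfl : s = [] := by simpa [alt] using hs
    exact pathOK_nil _ _
  · exact h s (by rw [alt_imp_of_ne hψ]; exact Finset.mem_union_right _ hs)

theorem AltOK.of_all {k : ℕ} {φ : Fml} (h : AltOK .minus k (all φ)) : AltOK .minus k φ :=
  fun _ hs => (h _ (Finset.mem_image_of_mem _ hs)).of_extend

theorem AltOK.of_ex {k : ℕ} {φ : Fml} (h : AltOK .plus k (ex φ)) : AltOK .plus k φ :=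
  fun _ hs => (h _ (Finset.mem_image_of_mem _ hs)).of_extend

theorem alt_nonempty (φ : Fml) : (alt φ).Nonempty := by
  induction φ with
  | eq t s => exact ⟨[], by simp [alt]⟩
  | bot => exact ⟨[], by simp [alt]⟩
  | and φ ψ ih _ | or φ ψ ih _ => exact ih.imp fun s hs => Finset.mem_union_left _ hs
  | imp φ ψ ih _ => exact ih.elim fun s hs => ⟨_, mem_alt_imp_left ψ hs⟩
  | all φ ih | ex φ ih => exact ih.image _

/-- Every path of a universal formula starts with `-`, so none may have the full length `k`; the
level drops by one and the sign changes. -/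
theorem AltOK.all_plus {k : ℕ} {φ : Fml} (h : AltOK .plus k (all φ)) :
    ∃ j, k = j + 1 ∧ AltOK .minus j (all φ) := by
  have hlt (s) (hs : s ∈ alt φ) : (extendPath .minus s).length < k :=
    (h _ (Finset.mem_image_of_mem _ hs)).lt_of_extend_flip
  obtain ⟨s, hs⟩ := alt_nonempty φ
  obtain ⟨j, rfl⟩ := Nat.exists_eq_succ_of_ne_zero (Nat.ne_zero_of_lt (hlt s hs))
  refine ⟨j, rfl, fun s hs => ?_⟩
  obtain ⟨s, hs', rfl⟩ := Finset.mem_image.1 hs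
  exact ⟨Nat.le_of_lt_succ (hlt s hs'), fun _ => Or.inr (head_extendPath _ _)⟩

theorem AltOK.ex_minus {k : ℕ} {φ : Fml} (h : AltOK .minus k (ex φ)) :
    ∃ j, k = j + 1 ∧ AltOK .plus j (ex φ) := by
  have hlt (s) (hs : s ∈ alt φ) : (extendPath .plus s).length < k :=
    (h _ (Finset.mem_image_of_mem _ hs)).lt_of_extend_flip
  obtain ⟨s, hs⟩ := alt_nonempty φ
  obtain ⟨j, rfl⟩ := Nat.exists_eq_succ_of_ne_zero (Nat.ne_zero_of_lt (hlt s hs))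
  refine ⟨j, rfl, fun s hs => ?_⟩
  obtain ⟨s, hs', rfl⟩ := Finset.mem_image.1 hs
  exact ⟨Nat.le_of_lt_succ (hlt s hs'), fun _ => Or.inr (head_extendPath _ _)⟩

theorem AltOK.length_ne_zero_of_all {a : Sgn} {φ : Fml} (h : AltOK a 0 (all φ)) : False := by
  obtain ⟨s, hs⟩ := alt_nonempty φ
  have h1 := (h _ (Finset.mem_image_of_mem _ hs)).1
  have h2 := head_extendPath .minus s
  rw [List.length_eq_zero_iff.1 (Nat.le_zero.1 h1)] at h2
  cases h2

theorem AltOK.length_ne_zero_of_ex {a : Sgn} {φ : Fml} (h : AltOK a 0 (ex φ)) : False := by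
  obtain ⟨s, hs⟩ := alt_nonempty φ
  have h1 := (h _ (Finset.mem_image_of_mem _ hs)).1
  have h2 := head_extendPath .plus s
  rw [List.length_eq_zero_iff.1 (Nat.le_zero.1 h1)] at h2
  cases h2

theorem AltOK.and {a : Sgn} {k : ℕ} {φ ψ : Fml} (h : AltOK a k (and φ ψ)) :
    AltOK a k φ ∧ AltOK a k ψ :=
  ⟨fun s hs => h s (Finset.mem_union_left _ hs), fun s hs => h s (Finset.mem_union_right _ hs)⟩

/-! ### Prenex normal forms of disjunction-free formulas -/

/-- The middle clause is what makes the induction close: it treats formulas of type `E_k` with only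
`Stab T k`, at the price of determining them up to negation. The first clause uses it for premises
of implications. -/
theorem prenex_of_disjFree (hT : ExtHA T) {φ : Fml} (hd : DisjFree φ) :
    (∀ k, Stab T k → AltOK .minus k φ → PiT T k φ) ∧
    (∀ k, Stab T k → AltOK .plus k φ → ∃ σ, SigT T k σ ∧ Eqv T (neg φ) (neg σ)) ∧
    (∀ k, Stab T (k + 1) → AltOK .plus k φ → SigT T k φ) := by
  induction φ with
  | eq t s =>
    exact ⟨fun _ _ _ => .of_qf trivial, fun _ _ _ => ⟨eq t s, .of_qf trivial, .refl _⟩,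
      fun _ _ _ => .of_qf trivial⟩
  | bot =>
    exact ⟨fun _ _ _ => .of_qf trivial, fun _ _ _ => ⟨bot, .of_qf trivial, .refl _⟩,
      fun _ _ _ => .of_qf trivial⟩
  | and φ ψ ih₁ ih₂ =>
    have ih₁ := ih₁ hd.1
    have ih₂ := ih₂ hd.2
    refine ⟨fun k hS h => (ih₁.1 k hS h.and.1).and (ih₂.1 k hS h.and.2), fun k hS h => ?_,
      fun k hS h => (ih₁.2.2 k hS h.and.1).and (ih₂.2.2 k hS h.and.2)⟩
    obtain ⟨σ, hσ, e⟩ := ih₁.2.1 k hS h.and.1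
    obtain ⟨τ, hτ, e'⟩ := ih₂.2.1 k hS h.and.2
    have key (φ ψ : Fml) : Eqv T (neg (Fml.and φ ψ)) (neg (Fml.and (neg (neg φ)) (neg (neg ψ)))) :=
      taut [φ, ψ] ((x₀ ⊓ x₁)ᶜ.iff (x₀ᶜᶜ ⊓ x₁ᶜᶜ)ᶜ) rfl
    exact ⟨_, hσ.and hτ, (key _ _).trans ((e.neg.and e'.neg).neg.trans (key _ _).symm)⟩
  | or φ ψ => exact hd.elim
  | imp φ ψ ih₁ ih₂ =>
    have ih₁ := ih₁ hd.1
    have ih₂ := ih₂ hd.2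
    refine ⟨fun k hS h => ?_, fun k hS h => ?_,
      fun k hS h => SigT.imp hT hS (ih₁.1 k (hS.mono (Nat.le_succ _)) h.imp_left)
        (ih₂.2.2 k hS h.imp_right)⟩
    · obtain ⟨σ, hσ, e⟩ := ih₁.2.1 k hS h.imp_left
      have hψ := ih₂.1 k hS h.imp_right
      -- The conclusion is stable, so the premise may be doubly negated and then exchanged for `σ`,
      -- which has the same negation.
      have key (φ : Fml) : Eqv T (imp φ ψ) (imp (neg (neg φ)) ψ) :=
        impE (taut [φ, ψ] ((x₁ᶜᶜ ⇨ x₁) ⇨ (x₀ ⇨ x₁).iff (x₀ᶜᶜ ⇨ x₁)) rfl) (hψ.stable hT hS)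
      exact (PiT.imp hT hS hσ hψ).eqv
        ((key φ).trans ((e.neg.imp (.refl _)).trans (key σ).symm))
    · have hφ := ih₁.1 k hS h.imp_left
      obtain ⟨σ, hσ, e⟩ := hφ.exists_neg hT hS
      obtain ⟨τ, hτ, e'⟩ := ih₂.2.1 k hS h.imp_right
      -- As `φ` is stable, the negated implication is `φ ∧ ¬ψ`, that is `¬σ ∧ ¬τ`, the negation of
      -- the `Σ_k` formula `σ ∨ τ`.
      have h1 : Eqv T (neg (imp φ ψ)) (Fml.and φ (neg ψ)) :=
        impE (taut [φ, ψ] ((x₀ᶜᶜ ⇨ x₀) ⇨ (x₀ ⇨ x₁)ᶜ.iff (x₀ ⊓ x₁ᶜ)) rfl) (hφ.stable hT hS)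
      have h2 : Eqv T (neg (Fml.or σ τ)) (Fml.and (neg σ) (neg τ)) :=
        taut [σ, τ] ((x₀ ⊔ x₁)ᶜ.iff (x₀ᶜ ⊓ x₁ᶜ)) rfl
      exact ⟨_, hσ.or hT hτ, h1.trans ((e.symm.and e').trans h2.symm)⟩
  | all φ ih =>
    have ih := ih hd
    have hU (k) (hS : Stab T k) (h : AltOK .minus k (all φ)) : PiT T k (all φ) := by
      cases k with
      | zero => exact h.length_ne_zero_of_all.elim
      | succ k => exact (ih.1 _ hS h.of_all).all
    refine ⟨hU, fun k hS h => ?_, fun k hS h => ?_⟩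
    · obtain ⟨j, rfl, h'⟩ := h.all_plus
      exact ⟨_, .of_pi (hU j (hS.mono (Nat.le_succ _)) h'), .refl _⟩
    · obtain ⟨j, rfl, h'⟩ := h.all_plus
      exact .of_pi (hU j (hS.mono (by omega)) h')
  | ex φ ih =>
    have ih := ih hd
    have hE (k) (hS : Stab T (k + 1)) (h : AltOK .plus k (ex φ)) : SigT T k (ex φ) := by
      cases k with
      | zero => exact h.length_ne_zero_of_ex.elim
      | succ k => exact (ih.2.2 _ hS h.of_ex).ex
    refine ⟨fun k hS h => ?_, fun k hS h => ?_, hE⟩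
    · obtain ⟨j, rfl, h'⟩ := h.ex_minus
      exact .of_sigma (hE j hS h')
    · cases k with
      | zero => exact h.length_ne_zero_of_ex.elim
      | succ k =>
        obtain ⟨σ, hσ, e⟩ := ih.2.1 _ hS h.of_ex
        exact ⟨_, hσ.ex, (Eqv.neg_ex φ).trans (e.all.trans (Eqv.neg_ex σ).symm)⟩

theorem altOK_of_mem_UClass {k : ℕ} {φ : Fml} (h : φ ∈ UClass k) : AltOK .minus k φ := by
  have hdeg : degree φ = k := by
    cases k with
    | zero => exact h
    | succ k => exact h.1
  refine fun s hs => ⟨hdeg ▸ Finset.le_sup (f := List.length) hs, fun e => ?_⟩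
  cases k with
  | zero => exact Or.inl (List.length_eq_zero_iff.1 e)
  | succ k => exact Or.inr (h.2 s hs e)

theorem altOK_of_mem_EClass {k : ℕ} {φ : Fml} (h : φ ∈ EClass k) : AltOK .plus k φ := by
  have hdeg : degree φ = k := by
    cases k with
    | zero => exact h
    | succ k => exact h.1
  refine fun s hs => ⟨hdeg ▸ Finset.le_sup (f := List.length) hs, fun e => ?_⟩
  cases k with
  | zero => exact Or.inl (List.length_eq_zero_iff.1 e)
  | succ k => exact Or.inr (h.2 s hs e)

/-! ### Adjustment of the free variables -/

/-- Serves to add free variables to a prenex formula: a provable quantifier-free conjunct is moved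
into the matrix. -/
theorem class_and_qf (k : ℕ) :
    (∀ φ ∈ SigmaClass k, ∀ δ, QF δ →
      ∃ φ' ∈ SigmaClass k, fv φ' = fv φ ∪ fv δ ∧ Eqv T (and φ δ) φ') ∧
    (∀ φ ∈ PiClass k, ∀ δ, QF δ →
      ∃ φ' ∈ PiClass k, fv φ' = fv φ ∪ fv δ ∧ Eqv T (and φ δ) φ') := by
  have hfv (δ : Fml) : {n | n + 1 ∈ fv (shift δ)} = fv δ := by
    ext n
    simp only [shift, Set.mem_ofPred_eq, mem_fv_subst]
    simp [FirstOrder.Language.Term.varFinset]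
  induction k with
  | zero =>
    exact ⟨fun φ hφ δ hδ => ⟨and φ δ, mem_sigma_zero.2 ⟨mem_sigma_zero.1 hφ, hδ⟩, rfl, .refl _⟩,
      fun φ hφ δ hδ => ⟨and φ δ, mem_pi_zero.2 ⟨mem_pi_zero.1 hφ, hδ⟩, rfl, .refl _⟩⟩
  | succ k ih =>
    constructor
    · intro φ
      refine sigma_rec (P := fun φ => ∀ δ, QF δ → ∃ φ' ∈ SigmaClass (k + 1),
        fv φ' = fv φ ∪ fv δ ∧ Eqv T (and φ δ) φ') (fun φ hφ δ hδ => ?_) (fun φ _ ih δ hδ => ?_)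
      · obtain ⟨φ', h, hf, e⟩ := ih.2 φ hφ δ hδ
        exact ⟨φ', sigma_of_pi h, hf, e⟩
      · obtain ⟨φ', h, hf, e⟩ := ih (shift δ) (hδ.subst _)
        refine ⟨ex φ', sigma_ex h, ?_, (Eqv.ex_and φ δ).trans e.ex⟩
        rw [← hfv δ]
        simp only [fv, hf]
        rfl
    · intro φ
      refine pi_rec (P := fun φ => ∀ δ, QF δ → ∃ φ' ∈ PiClass (k + 1),
        fv φ' = fv φ ∪ fv δ ∧ Eqv T (and φ δ) φ') (fun φ hφ δ hδ => ?_) (fun φ _ ih δ hδ => ?_)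
      · obtain ⟨φ', h, hf, e⟩ := ih.1 φ hφ δ hδ
        exact ⟨φ', pi_of_sigma h, hf, e⟩
      · obtain ⟨φ', h, hf, e⟩ := ih (shift δ) (hδ.subst _)
        refine ⟨all φ', pi_all h, ?_, (Eqv.all_and φ δ).trans e.all⟩
        rw [← hfv δ]
        simp only [fv, hf]
        rfl

/-- A provable quantifier-free formula with prescribed free variables. -/
theorem exists_qf_fv (hT : ExtHA T) {S : Set ℕ} (hS : S.Finite) :
    ∃ δ, QF δ ∧ fv δ = S ∧ Proves T δ := by
  induction S, hS using Set.Finite.induction_on with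
  | empty => exact ⟨imp bot bot, ⟨trivial, trivial⟩, by simp [fv], impI hyp0⟩
  | @insert n S _ _ ih =>
    obtain ⟨δ, h, hf, hp⟩ := ih
    refine ⟨and (eq (var n) (var n)) δ, ⟨trivial, h⟩, ?_, andI (hT.deriv (HA.eq_refl _)) hp⟩
    simp [fv, hf, FirstOrder.Language.Term.varFinset]

/-- The free variables of an equivalent formula can be adjusted within a class of formulas. -/
theorem exists_same_fv (hT : ExtHA T) {C : Set Fml} (hC : ∀ φ ∈ C, ∀ σ, subst σ φ ∈ C)
    (hC' : ∀ φ ∈ C, ∀ δ, QF δ → ∃ φ' ∈ C, fv φ' = fv φ ∪ fv δ ∧ Eqv T (and φ δ) φ')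
    {φ ψ : Fml} (hψ : ψ ∈ C) (e : Eqv T φ ψ) : ∃ φ' ∈ C, fv φ = fv φ' ∧ Eqv T φ φ' := by
  classical
  obtain ⟨δ, hδ, hf, hp⟩ := exists_qf_fv hT (fv_finite φ)
  -- Variables not free in `φ` are set to `0` in `ψ`, which leaves `φ` unchanged; the missing
  -- variables enter through `δ`.
  let σ : ℕ → Tm := fun n => if n ∈ fv φ then var n else zeroT
  have e' := e.subst σ
  rw [subst_congr φ (τ := var) (fun n hn => if_pos hn), subst_var] at e'
  obtain ⟨φ', h, hf', e''⟩ := hC' _ (hC ψ hψ σ) δ hδ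
  refine ⟨φ', h, ?_, e'.trans (.trans ?_ e'')⟩
  · rw [hf', hf, Set.union_eq_right.2]
    intro m hm
    obtain ⟨n, -, hm⟩ := (mem_fv_subst _ _ _).1 hm
    by_cases hn : n ∈ fv φ
    · simp [σ, hn, FirstOrder.Language.Term.varFinset] at hm
      exact hm ▸ hn
    · simp [σ, hn, zeroT, app, FirstOrder.Language.Term.varFinset] at hm
  · exact .intro (andI hyp0 (of_proves hp)) (andE₁ hyp0)

theorem pnft_sigma (hT : ExtHA T) {k : ℕ} (hS : Stab T (k + 1)) :
    PNFT T (df (EClass k)) (SigmaClass k) := by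
  rintro φ ⟨hφ, hd⟩
  obtain ⟨ψ, hψ, e⟩ := (prenex_of_disjFree hT hd).2.2 k hS (altOK_of_mem_EClass hφ)
  exact exists_same_fv hT (class_subst k).1 (class_and_qf k).1 hψ e

theorem pnft_pi (hT : ExtHA T) {k : ℕ} (hS : Stab T k) : PNFT T (df (UClass k)) (PiClass k) := by
  rintro φ ⟨hφ, hd⟩
  obtain ⟨ψ, hψ, e⟩ := (prenex_of_disjFree hT hd).1 k hS (altOK_of_mem_UClass hφ)
  exact exists_same_fv hT (class_subst k).2 (class_and_qf k).2 hψ e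

/-! ### The negative translation relative to a formula -/

/-- The negative translation in which `R` takes the place of falsity. -/
def Fml.tr : Fml → Fml → Fml
  | R, eq t s => imp (imp (eq t s) R) R
  | R, bot => R
  | R, and φ ψ => and (tr R φ) (tr R ψ)
  | R, or φ ψ => imp (imp (tr R φ) R) (imp (imp (tr R ψ) R) R)
  | R, imp φ ψ => imp (tr R φ) (tr R ψ)
  | R, all φ => all (tr (shift R) φ)
  | R, ex φ => imp (all (imp (tr (shift R) φ) (shift R))) R

theorem tr_subst (R φ : Fml) (σ : ℕ → Tm) : subst σ (tr R φ) = tr (subst σ R) (subst σ φ) := by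
  induction φ generalizing R σ <;> simp_all [tr, Fml.subst, subst_up_shift]

theorem tr_shift (R φ : Fml) : tr (shift R) (shift φ) = shift (tr R φ) := (tr_subst R φ _).symm

theorem tr_inst (R φ : Fml) (t : Tm) : inst (tr (shift R) φ) t = tr R (inst φ t) := by
  have := inst_shift R t
  rw [inst_eq] at this ⊢
  rw [tr_subst, this]; rfl

theorem tr_atSucc (R φ : Fml) : tr (shift R) (atSucc φ) = atSucc (tr (shift R) φ) := by
  rw [atSucc, atSucc, tr_subst]
  congr 1
  rw [shift, subst_subst]; rfl

theorem tr_ex_inst {Γ : List Fml} (R φ : Fml) :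
    Deriv T Γ (all (imp (tr (shift R) φ) (shift R))) ↔
      ∀ t, Deriv T Γ (imp (tr R (inst φ t)) R) := by
  have h (t : Tm) : inst (imp (tr (shift R) φ) (shift R)) t = imp (tr R (inst φ t)) R := by
    show imp (inst (tr (shift R) φ) t) (inst (shift R) t) = _
    rw [tr_inst, inst_shift]
  exact ⟨fun d t => h t ▸ allE t d, fun d => all_intro fun t => h t ▸ d t⟩

/-- Translated formulas are stable with respect to `R` as falsity, which is why classical reasoning
survives the translation. -/
theorem tr_stable (R φ : Fml) : Proves T (imp (imp (imp (tr R φ) R) R) (tr R φ)) := by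
  induction φ generalizing R with
  | eq t s => exact taut [eq t s, R] (((((x₀ ⇨ x₁) ⇨ x₁) ⇨ x₁) ⇨ x₁) ⇨ (x₀ ⇨ x₁) ⇨ x₁) rfl
  | bot => exact taut [R] (((x₀ ⇨ x₀) ⇨ x₀) ⇨ x₀) rfl
  | and φ ψ ih₁ ih₂ =>
    exact impE (impE (taut [tr R φ, tr R ψ, R] ((((x₀ ⇨ x₂) ⇨ x₂) ⇨ x₀) ⇨
      (((x₁ ⇨ x₂) ⇨ x₂) ⇨ x₁) ⇨ (((x₀ ⊓ x₁) ⇨ x₂) ⇨ x₂) ⇨ x₀ ⊓ x₁) rfl) (ih₁ R)) (ih₂ R)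
  | or φ ψ =>
    exact taut [imp (tr R φ) R, imp (tr R ψ) R, R]
      ((((x₀ ⇨ x₁ ⇨ x₂) ⇨ x₂) ⇨ x₂) ⇨ x₀ ⇨ x₁ ⇨ x₂) rfl
  | imp φ ψ _ ih =>
    exact impE (taut [tr R φ, tr R ψ, R] ((((x₁ ⇨ x₂) ⇨ x₂) ⇨ x₁) ⇨
      (((x₀ ⇨ x₁) ⇨ x₂) ⇨ x₂) ⇨ x₀ ⇨ x₁) rfl) (ih R)
  | all φ ih =>
    refine impI (all_intro fun t => ?_)
    have h := proves_subst (ih (shift R)) (scons t var)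
    simp only [Fml.subst, ← inst_eq, tr_inst, inst_shift] at h ⊢
    refine impE (of_proves h) (impI (impE hyp1 (impI (impE hyp1 ?_))))
    rw [← tr_inst]
    exact allE t hyp0
  | ex φ =>
    exact taut [all (imp (tr (shift R) φ) (shift R)), R]
      ((((x₀ ⇨ x₁) ⇨ x₁) ⇨ x₁) ⇨ x₀ ⇨ x₁) rfl

/-- Reasoning by contradiction for translated formulas. -/
theorem tr_apply {Γ : List Fml} {R φ : Fml} (h : Deriv T (imp (tr R φ) R :: Γ) R) :
    Deriv T Γ (tr R φ) := impE (of_proves (tr_stable R φ)) (impI h)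

/-- Induction and substitution of equals are schemata for all formulas, so their translations come
from instances for translated formulas; here `tr_apply` removes the `R`-negations around an
equation. -/
theorem tr_HAAxiom {φ : Fml} (h : HAAxiom φ) (R : Fml) : Deriv HA [] (tr R φ) := by
  have heq {t s : Tm} (h : Deriv HA [] (eq t s)) : Deriv HA [] (tr R (eq t s)) :=
    impI (impE hyp0 h.wk)
  cases h with
  | eqRefl t => exact heq (HA.eq_refl t)
  | eqSubst φ t s =>
    refine impI (impI (tr_apply (impE hyp2 (impI (impE hyp1 ?_)))))
    rw [← tr_inst R φ s]
    refine HA.eq_replace _ hyp0 ?_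
    rw [tr_inst R φ t]
    exact hyp2
  | succNeZero t => exact impI (impE hyp0 (impI (botE (impE (HA.ax (.succNeZero t)) hyp0))))
  | succInj t s =>
    exact impI (impI (impE hyp1 (impI (impE hyp1 (impE (HA.ax (.succInj t s)) hyp0)))))
  | proj i ts => exact heq (HA.ax (.proj i ts))
  | comp f g ts => exact heq (HA.ax (.comp f g ts))
  | precZero f g ts => exact heq (HA.ax (.precZero f g ts))
  | precSucc f g t ts => exact heq (HA.ax (.precSucc f g t ts))
  | induction φ =>
    have := HA.ax (Γ := []) (.induction (tr (shift R) φ))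
    rw [tr_inst, ← tr_atSucc] at this
    exact this

/-- Each classical rule is simulated with `R` as falsity. The translation of excluded middle is an
intuitionistic tautology, and ex falso holds because translated formulas follow from `R`. -/
theorem tr_sound {Γ : List Fml} {φ : Fml} (h : Deriv PA Γ φ) (R : Fml) :
    Deriv HA (Γ.map (tr R)) (tr R φ) := by
  have hmap (Γ : List Fml) (R : Fml) :
      (Γ.map shift).map (tr (shift R)) = (Γ.map (tr R)).map shift := by
    simp [Function.comp_def, tr_shift]
  induction h generalizing R with
  | ax h =>
    rcases h with h | ⟨φ, rfl⟩
    · exact of_proves (tr_HAAxiom h R)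
    · exact taut [tr R φ, R] ((x₀ ⇨ x₁) ⇨ ((x₀ ⇨ x₁) ⇨ x₁) ⇨ x₁) rfl
  | hyp h => exact hyp (List.mem_map_of_mem h)
  | botE _ ih => exact tr_apply (ih R).wk
  | andI _ _ ih₁ ih₂ => exact andI (ih₁ R) (ih₂ R)
  | andE₁ _ ih => exact andE₁ (ih R)
  | andE₂ _ ih => exact andE₂ (ih R)
  | orI₁ _ ih => exact impI (impI (impE hyp1 (ih R).wk.wk))
  | orI₂ _ ih => exact impI (impI (impE hyp0 (ih R).wk.wk))
  | orE _ _ _ ih ih₁ ih₂ =>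
    exact tr_apply (impE (impE (ih R).wk (impI (impE hyp1 ((ih₁ R).weaken
      (List.cons_subset_cons _ (List.subset_cons_self _ _))))))
      (impI (impE hyp1 ((ih₂ R).weaken (List.cons_subset_cons _ (List.subset_cons_self _ _))))))
  | impI _ ih => exact impI (ih R)
  | impE _ _ ih₁ ih₂ => exact impE (ih₁ R) (ih₂ R)
  | allI _ ih =>
    have := ih (shift R)
    rw [hmap] at this
    exact allI this
  | allE t _ ih =>
    rw [← tr_inst]
    exact allE t (ih R)
  | exI t _ ih => exact impI (impE ((tr_ex_inst R _).1 hyp0 t) (ih R).wk)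
  | exE _ _ ih₁ ih₂ =>
    have h2 := ih₂ (shift R)
    rw [List.map_cons, hmap, tr_shift] at h2
    refine tr_apply (impE (ih₁ R).wk ((tr_ex_inst R _).2 fun t => impI (impE hyp1 ?_)))
    have h3 := allE t (allI (impI h2))
    change Deriv HA _ (imp (inst (tr (shift R) _) t) (inst (shift (tr R _)) t)) at h3
    rw [tr_inst, inst_shift] at h3
    exact impE h3.wk.wk hyp0

/-! ### Conservation -/

/-- `T` proves the law of excluded middle, with parameters, for all `Σ_j` and `Π_j` with `j < k`. -/
def Lem (T : Set Fml) (k : ℕ) : Prop :=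
  ∀ j < k, ∀ φ, φ ∈ SigmaClass j ∨ φ ∈ PiClass j → Proves T (or φ (neg φ))

theorem Lem.mono {j k : ℕ} (h : Lem T k) (hjk : j ≤ k) : Lem T j :=
  fun i hi => h i (hi.trans_le hjk)

theorem Lem.stab {k : ℕ} (h : Lem T k) : Stab T k :=
  fun j hj φ hφ => .of_dec (h j hj φ (Or.inl hφ))

theorem dec_of_eqv {φ ψ : Fml} (h : Proves T (or ψ (neg ψ))) (e : Eqv T φ ψ) :
    Proves T (or φ (neg φ)) := (e.or e.neg).mpr h

/-- `T` proves that the translation of `φ` relative to any `R` is equivalent to `(φ → R) → R`. -/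
def TrOK (T : Set Fml) (φ : Fml) : Prop := ∀ R, Eqv T (tr R φ) (imp (imp φ R) R)

theorem trOK_of_qf (hT : ExtHA T) {φ : Fml} (h : QF φ) : TrOK T φ := by
  intro R
  induction φ with
  | eq t s => exact .refl _
  | bot => exact taut [R] (x₀.iff ((⊥ ⇨ x₀) ⇨ x₀)) rfl
  | and φ ψ ih₁ ih₂ =>
    exact ((ih₁ h.1).and (ih₂ h.2)).trans (taut [φ, ψ, R]
      ((((x₀ ⇨ x₂) ⇨ x₂) ⊓ ((x₁ ⇨ x₂) ⇨ x₂)).iff ((x₀ ⊓ x₁ ⇨ x₂) ⇨ x₂)) rfl)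
  | or φ ψ ih₁ ih₂ =>
    exact (((ih₁ h.1).imp (.refl R)).imp (((ih₂ h.2).imp (.refl R)).imp (.refl R))).trans
      (taut [φ, ψ, R] (((((x₀ ⇨ x₂) ⇨ x₂) ⇨ x₂) ⇨ (((x₁ ⇨ x₂) ⇨ x₂) ⇨ x₂) ⇨ x₂).iff
        ((x₀ ⊔ x₁ ⇨ x₂) ⇨ x₂)) rfl)
  | imp φ ψ ih₁ ih₂ =>
    exact ((ih₁ h.1).imp (ih₂ h.2)).trans (impE (taut [φ, ψ, R] ((x₀ ⊔ x₀ᶜ) ⇨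
      ((((x₀ ⇨ x₂) ⇨ x₂) ⇨ (x₁ ⇨ x₂) ⇨ x₂).iff (((x₀ ⇨ x₁) ⇨ x₂) ⇨ x₂))) rfl)
      (hT.deriv (HA.qf_dec h.1)))
  | all φ => exact h.elim
  | ex φ => exact h.elim

theorem TrOK.inst {φ : Fml} (h : TrOK T φ) (R : Fml) (t : Tm) :
    Eqv T (tr R (Fml.inst φ t)) (imp (imp (Fml.inst φ t) R) R) := by
  have h' := (h (shift R)).inst t
  change Eqv T _ (imp (imp (Fml.inst φ t) (Fml.inst (shift R) t)) (Fml.inst (shift R) t)) at h'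
  rwa [tr_inst, inst_shift] at h'

theorem TrOK.ex {φ : Fml} (h : TrOK T φ) : TrOK T (Fml.ex φ) := by
  intro R
  have hi := h.inst R
  refine .intro (impI (impE hyp1 ((tr_ex_inst R φ).2 fun t => impI ?_)))
    (impI (impE hyp1 (impI (ex_elim hyp0 fun t => ?_))))
  · exact impE ((hi t).mp hyp0) (impI (impE hyp2 (exI t hyp0)))
  · refine impE ((tr_ex_inst R φ).1 hyp2 t) ((hi t).mpr (impI (impE hyp0 hyp1)))

/-- The hard direction is to derive `R` from all `(φ(t) → R) → R` and `∀φ → R`. A counterexample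
`¬φ(t)` yields `R` at once; without one, stability gives `∀φ`. -/
theorem TrOK.all {φ : Fml} (h : TrOK T φ) (hs : Stable T φ)
    (hd : Proves T (or (Fml.ex (neg φ)) (neg (Fml.ex (neg φ))))) : TrOK T (Fml.all φ) := by
  intro R
  have hi := h.inst R
  refine .intro (impI (orE (of_proves hd) (ex_elim hyp0 fun t => ?_) (impE hyp1 ?_)))
    (all_intro fun t => ?_)
  · have h1 : Deriv T [Fml.inst (neg φ) t, Fml.ex (neg φ), imp (Fml.all φ) R, tr R (Fml.all φ)]
        (Fml.inst (tr (shift R) φ) t) := allE t (hyp (by simp [tr]))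
    rw [tr_inst] at h1
    exact impE ((hi t).mp h1) (impI (botE (impE hyp1 hyp0)))
  · exact all_intro fun t => (hs.inst t).apply (impE hyp1 (exI t hyp0))
  · rw [tr_inst]
    exact (hi t).mpr (impI (impE hyp1 (impI (impE hyp1 (allE t hyp0)))))

/-- `∃` comes for free, while each `∀` needs decidability of `∃¬φ`, a `Σ` formula of the same level;
hence the bounds `k` and `k + 1`. -/
theorem trOK_of_class (hT : ExtHA T) (k : ℕ) :
    (Lem T k → ∀ φ ∈ SigmaClass k, TrOK T φ) ∧ (Lem T (k + 1) → ∀ φ ∈ PiClass k, TrOK T φ) := by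
  induction k with
  | zero =>
    exact ⟨fun _ φ h => trOK_of_qf hT (mem_sigma_zero.1 h),
      fun _ φ h => trOK_of_qf hT (mem_pi_zero.1 h)⟩
  | succ k ih =>
    constructor
    · intro hL φ
      exact sigma_rec (P := TrOK T) (ih.2 hL) fun φ _ h => h.ex
    · intro hL φ
      have hS := hL.stab
      refine pi_rec (P := TrOK T) (ih.1 (hL.mono (by omega))) fun φ hφ h => ?_
      have hφ' : PiT T (k + 1) φ := .of_mem hφ
      obtain ⟨ψ, hψ, e⟩ := (hφ'.neg hT hS).ex
      exact h.all (hφ'.stable hT (hS.mono (Nat.le_succ _)))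
        (dec_of_eqv (hL _ (Nat.lt_succ_self _) ψ (Or.inl hψ)) e)

/-- Implications between `Σ_k` formulas are conservative over excluded middle below `k`. -/
theorem conservation (hT : ExtHA T) {k : ℕ} (hL : Lem T k) {φ ψ : Fml} (hφ : φ ∈ SigmaClass k)
    (hψ : ψ ∈ SigmaClass k) (h : Proves PA (imp φ ψ)) : Proves T (imp φ ψ) := by
  -- With `R := ψ`, the premise `φ` gives `(φ → ψ) → ψ`, and the translated conclusion `(ψ → ψ) → ψ`
  -- amounts to `ψ`.
  have h1 : Proves T (imp (tr ψ φ) (tr ψ ψ)) := hT.deriv (tr_sound h ψ)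
  have hφ' := (trOK_of_class hT k).1 hL φ hφ ψ
  have hψ' := (trOK_of_class hT k).1 hL ψ hψ ψ
  exact impI (impE (hψ'.mp (impE (of_proves h1) (hφ'.mpr (impI (impE hyp0 hyp1))))) (impI hyp0))

/-! ### Schemata with one variable and with parameters -/

theorem proves_of_all {φ : Fml} (h : Proves T (all φ)) : Proves T φ := by
  have h1 := allE (var 0) (proves_subst h fun n => var (n + 1))
  rw [inst_subst_up] at h1
  rwa [show scons (var 0) (fun n => var (n + 1)) = var by funext n; cases n <;> rfl,
    subst_var] at h1

theorem proves_of_alls {φ : Fml} {n : ℕ} (h : Proves T (alls n φ)) : Proves T φ := by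
  induction n with
  | zero => exact h
  | succ n ih => exact ih (proves_of_all h)

theorem proves_alls {φ : Fml} (h : Proves T φ) : ∀ n, Proves T (alls n φ)
  | 0 => h
  | n + 1 => allI (proves_alls h n)

theorem stab_of_dne (hT : ExtHA T) {k : ℕ} (h : ProvesAll T (DNE (SigmaClass k))) :
    Stab T (k + 1) := fun _ hj φ hφ =>
  hT.proves_of_coded (φ := imp (neg (neg φ)) φ) (proves_of_all (h _
    ⟨_, (class_subst k).1 φ (sigma_mono (Nat.le_of_lt_succ hj) hφ) _, fv_coded φ, rfl⟩))

theorem dne_of_stab {k : ℕ} (h : Stab T (k + 1)) : ProvesAll T (DNE (SigmaClass k)) := by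
  rintro _ ⟨φ, hφ, -, rfl⟩
  exact allI (h k k.lt_succ_self φ hφ)

theorem dec_of_lem (hT : ExtHA T) {j k : ℕ} (h : ProvesAll T (LEM (PiClass k))) (hj : j ≤ k)
    {φ : Fml} (hφ : φ ∈ PiClass j) : Proves T (or φ (neg φ)) :=
  hT.proves_of_coded (φ := or φ (neg φ)) (proves_of_all (h _
    ⟨_, (class_subst k).2 φ (pi_mono hj hφ) _, fv_coded φ, rfl⟩))

/-- For `φ` in `Σ_j` the negation is `Π_j`, hence decidable; if `¬¬φ` holds, stability gives `φ`. -/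
theorem Stab.lem (hT : ExtHA T) {k : ℕ} (hS : Stab T k)
    (hL : ∀ j < k, ∀ φ ∈ PiClass j, Proves T (or φ (neg φ))) : Lem T k := by
  rintro j hj φ (hφ | hφ)
  · obtain ⟨ψ, hψ, e⟩ := (SigT.of_mem hφ).neg hT (hS.mono hj.le)
    exact impE (impE (taut [φ] ((x₀ᶜ ⊔ x₀ᶜᶜ) ⇨ (x₀ᶜᶜ ⇨ x₀) ⇨ x₀ ⊔ x₀ᶜ) rfl)
      (dec_of_eqv (hL j hj ψ hψ) e)) (hS j hj φ hφ)
  · exact hL j hj φ hφ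

/-! ### Prenex formulas with a single alternation path -/

/-- The alternating path of length `k` that starts with `a`. -/
def altSeq : Sgn → ℕ → List Sgn
  | _, 0 => []
  | a, k + 1 => a :: altSeq a.flip k

@[simp] theorem length_altSeq (a : Sgn) (k : ℕ) : (altSeq a k).length = k := by
  induction k generalizing a with
  | zero => rfl
  | succ k ih => simp [altSeq, ih]

theorem extendPath_altSeq (a : Sgn) (k : ℕ) :
    extendPath a (altSeq a.flip k) = altSeq a (k + 1) := by
  rw [extendPath, if_neg]
  · rfl
  · cases k with
    | zero => simp [altSeq]
    | succ k => simpa [altSeq] using a.flip_ne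

theorem extendPath_altSeq_self (a : Sgn) (k : ℕ) :
    extendPath a (altSeq a (k + 1)) = altSeq a (k + 1) := by simp [extendPath, altSeq]

theorem alt_subst (φ : Fml) (σ : ℕ → Tm) : alt (subst σ φ) = alt φ := by
  induction φ generalizing σ with
  | eq t s => rfl
  | bot => rfl
  | and φ ψ ih₁ ih₂ | or φ ψ ih₁ ih₂ => simp only [Fml.subst, alt, ih₁, ih₂]
  | imp φ ψ ih₁ ih₂ =>
    by_cases h : ψ = bot
    · subst h
      simp only [Fml.subst, alt, ih₁]
    · have h' : Fml.subst σ ψ ≠ bot := by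
        cases ψ <;> simp [Fml.subst] at h ⊢
      simp only [Fml.subst, alt_imp_of_ne h, alt_imp_of_ne h', ih₁, ih₂]
  | all φ ih | ex φ ih => simp only [Fml.subst, alt, ih]

theorem disjFree_subst {φ : Fml} (h : DisjFree φ) (σ : ℕ → Tm) : DisjFree (subst σ φ) := by
  induction φ generalizing σ with
  | eq t s => trivial
  | bot => trivial
  | and φ ψ ih₁ ih₂ | imp φ ψ ih₁ ih₂ => exact ⟨ih₁ h.1 σ, ih₂ h.2 σ⟩
  | or φ ψ => exact h.elim
  | all φ ih | ex φ ih => exact ih h _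

theorem alt_of_qf {φ : Fml} (h : QF φ) : alt φ = {[]} := by
  induction φ with
  | eq t s => rfl
  | bot => rfl
  | and φ ψ ih₁ ih₂ | or φ ψ ih₁ ih₂ => simp [alt, ih₁ h.1, ih₂ h.2]
  | imp φ ψ ih₁ ih₂ =>
    by_cases hψ : ψ = bot
    · subst hψ
      simp [alt, ih₁ h.1]
    · simp [alt_imp_of_ne hψ, ih₁ h.1, ih₂ h.2]
  | all φ => exact h.elim
  | ex φ => exact h.elim

theorem exists_disjFree_qf (hT : ExtHA T) {φ : Fml} (h : QF φ) :
    ∃ φ', QF φ' ∧ DisjFree φ' ∧ Eqv T φ φ' := by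
  induction φ with
  | eq t s => exact ⟨_, h, trivial, .refl _⟩
  | bot => exact ⟨_, h, trivial, .refl _⟩
  | and φ ψ ih₁ ih₂ =>
    obtain ⟨φ', h₁, d₁, e₁⟩ := ih₁ h.1
    obtain ⟨ψ', h₂, d₂, e₂⟩ := ih₂ h.2
    exact ⟨and φ' ψ', ⟨h₁, h₂⟩, ⟨d₁, d₂⟩, e₁.and e₂⟩
  | imp φ ψ ih₁ ih₂ =>
    obtain ⟨φ', h₁, d₁, e₁⟩ := ih₁ h.1
    obtain ⟨ψ', h₂, d₂, e₂⟩ := ih₂ h.2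
    exact ⟨imp φ' ψ', ⟨h₁, h₂⟩, ⟨d₁, d₂⟩, e₁.imp e₂⟩
  | or φ ψ ih₁ ih₂ =>
    obtain ⟨φ', h₁, d₁, e₁⟩ := ih₁ h.1
    obtain ⟨ψ', h₂, d₂, e₂⟩ := ih₂ h.2
    refine ⟨neg (and (neg φ') (neg ψ')), ⟨⟨⟨h₁, trivial⟩, ⟨h₂, trivial⟩⟩, trivial⟩,
      ⟨⟨⟨d₁, trivial⟩, ⟨d₂, trivial⟩⟩, trivial⟩, (e₁.or e₂).trans ?_⟩
    exact impE (impE (taut [φ', ψ'] ((x₀ ⊔ x₀ᶜ) ⇨ (x₁ ⊔ x₁ᶜ) ⇨ (x₀ ⊔ x₁).iff (x₀ᶜ ⊓ x₁ᶜ)ᶜ) rfl)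
      (hT.deriv (HA.qf_dec h₁))) (hT.deriv (HA.qf_dec h₂))
  | all φ => exact h.elim
  | ex φ => exact h.elim

/-- Prenex classes allow empty blocks, the classes `E_k` and `U_k` prescribe the exact degree. Dummy
quantifiers fill each block, and disjunctions in the decidable matrix are eliminated. -/
theorem exists_single_path (hT : ExtHA T) (k : ℕ) :
    (∀ φ ∈ SigmaClass k, ∃ φ' ∈ SigmaClass k,
      DisjFree φ' ∧ alt φ' = {altSeq .plus k} ∧ Eqv T φ φ') ∧
    (∀ φ ∈ PiClass k, ∃ φ' ∈ PiClass k,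
      DisjFree φ' ∧ alt φ' = {altSeq .minus k} ∧ Eqv T φ φ') := by
  induction k with
  | zero =>
    constructor
    · intro φ hφ
      obtain ⟨φ', h, d, e⟩ := exists_disjFree_qf hT (mem_sigma_zero.1 hφ)
      exact ⟨φ', mem_sigma_zero.2 h, d, alt_of_qf h, e⟩
    · intro φ hφ
      obtain ⟨φ', h, d, e⟩ := exists_disjFree_qf hT (mem_pi_zero.1 hφ)
      exact ⟨φ', mem_pi_zero.2 h, d, alt_of_qf h, e⟩
  | succ k ih =>
    constructor
    · intro φ
      refine sigma_rec (P := fun φ => ∃ φ' ∈ SigmaClass (k + 1),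
        DisjFree φ' ∧ alt φ' = {altSeq .plus (k + 1)} ∧ Eqv T φ φ') ?_ ?_
      · intro φ hφ
        obtain ⟨φ', h, d, a, e⟩ := ih.2 φ hφ
        refine ⟨ex (shift φ'), sigma_ex (sigma_of_pi ((class_subst k).2 _ h _)),
          disjFree_subst d _, ?_, e.trans (.ex_shift φ')⟩
        simp only [alt, shift, alt_subst, a, Finset.image_singleton]
        rw [← extendPath_altSeq]; rfl
      · rintro φ - ⟨φ', h, d, a, e⟩
        refine ⟨ex φ', sigma_ex h, d, ?_, e.ex⟩
        simp only [alt, a, Finset.image_singleton, extendPath_altSeq_self]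
    · intro φ
      refine pi_rec (P := fun φ => ∃ φ' ∈ PiClass (k + 1),
        DisjFree φ' ∧ alt φ' = {altSeq .minus (k + 1)} ∧ Eqv T φ φ') ?_ ?_
      · intro φ hφ
        obtain ⟨φ', h, d, a, e⟩ := ih.1 φ hφ
        refine ⟨all (shift φ'), pi_all (pi_of_sigma ((class_subst k).1 _ h _)),
          disjFree_subst d _, ?_, e.trans (.all_shift φ')⟩
        simp only [alt, shift, alt_subst, a, Finset.image_singleton]
        rw [← extendPath_altSeq]; rfl
      · rintro φ - ⟨φ', h, d, a, e⟩
        refine ⟨all φ', pi_all h, d, ?_, e.all⟩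
        simp only [alt, a, Finset.image_singleton, extendPath_altSeq_self]

theorem alt_neg_neg (φ : Fml) : alt (neg (neg φ)) = alt φ := by
  show ((alt φ).image (List.map Sgn.flip)).image (List.map Sgn.flip) = alt φ
  rw [Finset.image_image]
  have : List.map Sgn.flip ∘ List.map Sgn.flip = id := by
    funext s
    simp [Function.comp_def]
  rw [this, Finset.image_id]

theorem mem_EClass_of_alt {k : ℕ} {φ : Fml} (h : alt φ = {altSeq .plus k}) : φ ∈ EClass k := by
  have hdeg : degree φ = k := by simp [degree, h]
  cases k with
  | zero => exact hdeg
  | succ k =>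
    refine ⟨hdeg, fun s hs _ => ?_⟩
    rw [h, Finset.mem_singleton] at hs
    rw [hs]; rfl

/-- Without the outer `∀`, both signs begin a path of length `k + 1`. The dummy `∀` lengthens only
the path starting with `+`, so the unique longest path starts with `-`. -/
theorem mem_UClass_of_alt {k : ℕ} {φ : Fml} (h : alt φ = {altSeq .plus (k + 1)}) :
    all (shift (imp (neg (neg φ)) φ)) ∈ UClass (k + 2) := by
  have hne : φ ≠ bot := by
    rintro rfl
    simp [alt, altSeq] at h
  have halt : alt (all (shift (imp (neg (neg φ)) φ))) =
      {extendPath .minus ((altSeq .plus (k + 1)).map Sgn.flip), altSeq .minus (k + 2)} := by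
    have : extendPath .minus (altSeq .plus (k + 1)) = altSeq .minus (k + 2) :=
      extendPath_altSeq .minus (k + 1)
    rw [alt, shift, alt_subst, alt_imp_of_ne hne, alt_neg_neg, h, Finset.image_singleton,
      Finset.image_union, Finset.image_singleton, Finset.image_singleton, this]
    rfl
  have hlen : (extendPath .minus ((altSeq .plus (k + 1)).map Sgn.flip)).length = k + 1 := by
    rw [extendPath, if_pos (by simp [altSeq, Sgn.flip]), List.length_map, length_altSeq]
  refine ⟨?_, fun s hs _ => ?_⟩
  · show degree _ = _
    simp [degree, halt, hlen]
  · rw [halt, Finset.mem_insert, Finset.mem_singleton] at hs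
    rcases hs with rfl | rfl
    · exact head_extendPath _ _
    · rfl

/-! ### Double negation elimination from prenex normal forms -/

theorem stable_PA (φ : Fml) : Stable PA φ := .of_dec (ax (Or.inr ⟨φ, rfl⟩))

theorem stab_of_pnft_sigma (hT : ExtHA T) (hPA : ∀ φ, Proves T φ → Proves PA φ) (k : ℕ)
    (hL : ∀ j < k, ∀ φ ∈ PiClass j, Proves T (or φ (neg φ)))
    (h : ∀ k' ≤ k, PNFT T (df (EClass k')) (SigmaClass k')) : Stab T (k + 1) := by
  induction k with
  | zero =>
    intro j hj φ hφ
    obtain rfl : j = 0 := by omega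
    exact .of_dec (hT.deriv (HA.qf_dec (mem_sigma_zero.1 hφ)))
  | succ k ih =>
    have hS := ih (fun j hj => hL j (hj.trans k.lt_succ_self))
      fun j hj => h j (hj.trans k.le_succ)
    -- Excluded middle strictly below level `k + 1` is exactly what `conservation` asks for
    -- `Σ_{k+1}` formulas.
    have hLem := hS.lem hT hL
    intro j hj φ hφ
    obtain ⟨φ', hφ', hd, ha, e⟩ :=
      (exists_single_path hT (k + 1)).1 φ (sigma_mono (Nat.le_of_lt_succ hj) hφ)
    obtain ⟨ψ, hψ, -, e'⟩ := h (k + 1) le_rfl (neg (neg φ'))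
      ⟨mem_EClass_of_alt ((alt_neg_neg φ').trans ha), ⟨hd, trivial⟩, trivial⟩
    replace e' : Eqv T (neg (neg φ')) ψ := e'
    have e'' : Eqv PA (neg (neg φ')) ψ := hPA _ e'
    have hPA' : Proves PA (imp ψ φ') :=
      impI (impE (of_proves (stable_PA φ')) (e''.mpr hyp0))
    exact Stable.eqv (impI (impE (of_proves (conservation hT hLem hψ hφ' hPA')) (e'.mp hyp0))) e

theorem stab_of_pnft_pi (hT : ExtHA T) (hPA : ∀ φ, Proves T φ → Proves PA φ) (k : ℕ)
    (hL : ∀ j, j + 1 < k → ∀ φ ∈ PiClass j, Proves T (or φ (neg φ)))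
    (h : ∀ k' ≤ k, PNFT T (df (UClass k')) (PiClass k')) : Stab T k := by
  induction k with
  | zero => exact fun j hj => (Nat.not_lt_zero j hj).elim
  | succ k ih =>
    have hS := ih (fun j hj => hL j (hj.trans k.lt_succ_self))
      fun j hj => h j (hj.trans k.le_succ)
    have hLem := hS.lem hT fun j hj => hL j (Nat.succ_lt_succ hj)
    intro j hj φ hφ
    replace hφ := sigma_mono (Nat.le_of_lt_succ hj) hφ
    -- Level `0` is decidable in `HA`. It must be set apart, since `mem_UClass_of_alt` needs a
    -- formula with at least one quantifier.
    cases k with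
    | zero => exact .of_dec (hT.deriv (HA.qf_dec (mem_sigma_zero.1 hφ)))
    | succ k =>
      obtain ⟨φ', -, hd, ha, e⟩ := (exists_single_path hT (k + 1)).1 φ hφ
      have hd' : DisjFree (imp (neg (neg φ')) φ') := ⟨⟨⟨hd, trivial⟩, trivial⟩, hd⟩
      obtain ⟨ψ, hψ, -, e'⟩ := h (k + 2) le_rfl _ ⟨mem_UClass_of_alt ha, disjFree_subst hd' _⟩
      obtain ⟨n, χ, hχ, rfl⟩ := mem_pi_succ.1 hψ
      replace e' : Eqv T (imp (neg (neg φ')) φ') (alls n χ) := (Eqv.all_shift _).trans e'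
      have e'' : Eqv PA (imp (neg (neg φ')) φ') (alls n χ) := hPA _ e'
      have h1 : Proves PA χ := proves_of_alls (e''.mp (stable_PA φ'))
      -- A theorem is transferred as an implication from the trivial `Σ` formula `⊥ → ⊥`.
      have h2 : Proves T χ := impE (conservation hT hLem
        (class_of_qf (φ := imp bot bot) ⟨trivial, trivial⟩ _).1 hχ (impI (of_proves h1)))
        (impI hyp0)
      exact Stable.eqv (e'.mpr (proves_alls h2 n)) e

end HeytingArith

-- The two equivalences

open HeytingArith
theorem mainTheorem9 (k : ℕ) :
    (∀ T : Set Fml,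
      InBetween (HA ∪ (if k = 0 then ∅ else LEM (PiClass (k - 1)))) T PA →
      (ProvesAll T (DNE (SigmaClass k)) ↔ ∀ k' ≤ k, PNFT T (df (EClass k')) (SigmaClass k'))) ∧
    (∀ T : Set Fml,
      InBetween (HA ∪ (if k < 2 then ∅ else LEM (PiClass (k - 2)))) T PA →
      (ProvesAll T (if k = 0 then ∅ else DNE (SigmaClass (k - 1))) ↔
        ∀ k' ≤ k, PNFT T (df (UClass k')) (PiClass k'))) := by
  constructor
  · rintro T ⟨hST, hPA⟩
    have hT : ExtHA T := fun φ hφ => hST φ (.ax (Or.inl hφ))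
    refine ⟨fun h k' hk' => pnft_sigma hT ((stab_of_dne hT h).mono (by omega)),
      fun h => dne_of_stab (stab_of_pnft_sigma hT hPA k (fun j hj φ hφ => ?_) h)⟩
    -- The existence of some `j < k` excludes `k = 0`, the case of the empty schema.
    rw [if_neg (by omega)] at hST
    exact dec_of_lem hT (fun χ hχ => hST χ (.ax (Or.inr hχ))) (show j ≤ k - 1 by omega) hφ
  · rintro T ⟨hST, hPA⟩
    have hT : ExtHA T := fun φ hφ => hST φ (.ax (Or.inl hφ))
    have hdne : ProvesAll T (if k = 0 then ∅ else DNE (SigmaClass (k - 1))) ↔ Stab T k := by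
      cases k with
      | zero => exact ⟨fun _ j hj => (Nat.not_lt_zero j hj).elim, fun _ φ hφ => hφ.elim⟩
      | succ k => exact ⟨fun h => stab_of_dne hT h, fun h => dne_of_stab h⟩
    rw [hdne]
    refine ⟨fun h k' hk' => pnft_pi hT (h.mono hk'),
      fun h => stab_of_pnft_pi hT hPA k (fun j hj φ hφ => ?_) h⟩
    -- Here `j + 1 < k` forces `k ≥ 2`, so the LEM schema is present.
    rw [if_neg (by omega)] at hST
    exact dec_of_lem hT (fun χ hχ => hST χ (.ax (Or.inr hχ))) (show j ≤ k - 2 by omega) hφ
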